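/- Let $M$ be a connected smooth manifold (real, finite-dimensional, Hausdorff, second-countable), let $\pi : E \to M$ be a smooth real vector bundle of finite rank, and let $[-,-,-]$ make $E$ a para-associative algebroid; that is, $[-,-,-]$ is a $C^\infty(M)$-trilinear product on the module $\mathrm{Sec}(E)$ of smooth sections such that $$\big[[u_1,u_2,u_3],u_4,u_5\big] = \big[u_1,[u_4,u_3,u_2],u_5\big] = \big[u_1,u_2,[u_3,u_4,u_5]\big]$$ for all $u_i \in \mathrm{Sec}(E)$. Each fibre $E_m$ is then a real para-associative algebra (a real vector space with a trilinear product satisfying the same identities) with product $[u(m),v(m),w(m)] := [u,v,w](m)$, which does not depend on the choice of the sections. The following are equivalent: 1. (Local triviality) $E$ with these fibre products is a para-associative algebra bundle: every point of $M$ has an open neighbourhood $U$ for which there are a real para-associative algebra $\mathcal{A}$ and a fibre-preserving diffeomorphism $\psi : \pi^{-1}(U) \to U \times \mathcal{A}$ that restricts to an isomorphism of para-associative algebras $\psi_n : E_n \to \mathcal{A}$ for every $n \in U$. 2. $E$ admits a differential connection: a smooth linear connection $\nabla$ on $E$ such that $$\nabla_X[u,v,w] = [\nabla_X u,v,w] +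 [u,\nabla_X v,w] + [u,v,\nabla_X w]$$ for all smooth vector fields $X$ on $M$ and all $u,v,w \in \mathrm{Sec}(E)$. -/

import Mathlib

open Bundle Manifold
open scoped ContDiff Topology

/-- A (ternary) para-associative algebra structure on an `R`-module `A`: an `R`-trilinear product
`[x, y, z]` satisfying
`[[x₁, x₂, x₃], x₄, x₅] = [x₁, [x₄, x₃, x₂], x₅] = [x₁, x₂, [x₃, x₄, x₅]]`. -/
structure ParaAssociativeAlgebra (R A : Type*) [CommRing R] [AddCommGroup A] [Module R A] where
  /-- The ternary product, as a trilinear map. -/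
  bracket : A →ₗ[R] A →ₗ[R] A →ₗ[R] A
  para_left : ∀ x₁ x₂ x₃ x₄ x₅ : A,
    bracket (bracket x₁ x₂ x₃) x₄ x₅ = bracket x₁ (bracket x₄ x₃ x₂) x₅
  para_right : ∀ x₁ x₂ x₃ x₄ x₅ : A,
    bracket x₁ (bracket x₄ x₃ x₂) x₅ = bracket x₁ x₂ (bracket x₃ x₄ x₅)

/-- `φ` is an isomorphism of the para-associative algebras `P` and `Q`: a linear isomorphism that
respects the ternary products. -/
def ParaAssociativeAlgebra.IsIso {R A B : Type*} [CommRing R] [AddCommGroup A] [Module R A]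
    [AddCommGroup B] [Module R B] (P : ParaAssociativeAlgebra R A) (Q : ParaAssociativeAlgebra R B)
    (φ : A ≃ₗ[R] B) : Prop :=
  ∀ x y z : A, φ (P.bracket x y z) = Q.bracket (φ x) (φ y) (φ z)

noncomputable section

section Sections

variable {E : Type*} [NormedAddCommGroup E] [NormedSpace ℝ E]
  {H : Type*} [TopologicalSpace H] {I : ModelWithCorners ℝ E H}
  {M : Type*} [TopologicalSpace M] [ChartedSpace H M]
  {F : Type*} [NormedAddCommGroup F] [NormedSpace ℝ F]
  {V : M → Type*} [TopologicalSpace (TotalSpace F V)]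
  [∀ x, AddCommGroup (V x)] [∀ x, Module ℝ (V x)] [∀ x, TopologicalSpace (V x)]
  [FiberBundle F V] [VectorBundle ℝ F V]

/-- Pointwise multiplication of a smooth section by a smooth function. -/
instance smoothSectionSMul : SMul C^∞⟮I, M; 𝓘(ℝ, ℝ), ℝ⟯ Cₛ^∞⟮I; F, V⟯ :=
  ⟨fun f s ↦ ⟨fun x ↦ f x • s x, f.contMDiff.smul_section s.contMDiff⟩⟩

theorem smoothSection_smul_apply (f : C^∞⟮I, M; 𝓘(ℝ, ℝ), ℝ⟯) (s : Cₛ^∞⟮I; F, V⟯) (x : M) :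
    (f • s) x = f x • s x := rfl

/-- The smooth sections of a vector bundle form a module over the ring of smooth functions. -/
instance smoothSectionModule : Module C^∞⟮I, M; 𝓘(ℝ, ℝ), ℝ⟯ Cₛ^∞⟮I; F, V⟯ where
  one_smul s := by ext x; exact one_smul ℝ (s x)
  mul_smul f g s := by ext x; exact mul_smul (f x) (g x) (s x)
  smul_zero f := by ext x; exact smul_zero (f x)
  smul_add f s t := by ext x; exact smul_add (f x) (s x) (t x)
  add_smul f g s := by ext x; exact add_smul (f x) (g x) (s x)
  zero_smul s := by ext x; exact zero_smul ℝ (s x)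

variable (I F V) in
/-- A para-associative algebroid structure on the vector bundle `V`: a para-associative
`C^∞(M)`-algebra structure on its module of smooth sections. -/
abbrev ParaAssociativeAlgebroid : Type _ :=
  ParaAssociativeAlgebra C^∞⟮I, M; 𝓘(ℝ, ℝ), ℝ⟯ Cₛ^∞⟮I; F, V⟯

end Sections

section Fibres

variable {E : Type*} [NormedAddCommGroup E] [NormedSpace ℝ E] [FiniteDimensional ℝ E]
  {H : Type*} [TopologicalSpace H] {I : ModelWithCorners ℝ E H}
  {M : Type*} [TopologicalSpace M] [ChartedSpace H M] [IsManifold I ∞ M] [T2Space M]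
  {F : Type*} [NormedAddCommGroup F] [NormedSpace ℝ F]
  {V : M → Type*} [TopologicalSpace (TotalSpace F V)]
  [∀ x, AddCommGroup (V x)] [∀ x, Module ℝ (V x)] [∀ x, TopologicalSpace (V x)]
  [FiberBundle F V] [VectorBundle ℝ F V]


theorem exists_smooth_cutoff (m : M) {U : Set M} (hU : IsOpen U) (hm : m ∈ U) :
    ∃ ρ : C^∞⟮I, M; 𝓘(ℝ, ℝ), ℝ⟯, ρ m = 1 ∧ tsupport ρ ⊆ U := by
  obtain ⟨f, -, hf⟩ := (SmoothBumpFunction.nhds_basis_tsupport (I := I) m).mem_iff.1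
    (hU.mem_nhds hm)
  exact ⟨⟨f, f.contMDiff⟩, f.eq_one, hf⟩

variable [ContMDiffVectorBundle ∞ F V I]

/-- Every vector of a fibre is the value of a global smooth section. -/
theorem exists_smoothSection_eq (m : M) (α : V m) : ∃ u : Cₛ^∞⟮I; F, V⟯, u m = α := by
  obtain ⟨s, hs, hsm⟩ := FiberBundle.exists_contMDiffOn_extend (k := ∞) I F α
  obtain ⟨ρ, h1, hρ⟩ := exists_smooth_cutoff (I := I) m isOpen_interior (mem_interior_iff_mem_nhds.2 hs)
  refine ⟨⟨_, ContMDiffOn.smul_section_of_tsupport ρ.contMDiff.contMDiffOn isOpen_interior hρ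
    (hsm.mono interior_subset)⟩, ?_⟩
  change ρ m • FiberBundle.extend F α m = α
  simp [h1]

/-- A global smooth section through a given vector of a fibre. -/
def sectionThrough (m : M) (α : V m) : Cₛ^∞⟮I; F, V⟯ := (exists_smoothSection_eq m α).choose

theorem sectionThrough_apply (m : M) (α : V m) :
    (sectionThrough m α : Cₛ^∞⟮I; F, V⟯) m = α := (exists_smoothSection_eq m α).choose_spec

variable [FiniteDimensional ℝ F]

/-- A `C^∞(M)`-linear map on sections sends a section vanishing at `m` to a section vanishing
at `m`. -/
theorem smoothSection_map_eq_zero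
    (Φ : Cₛ^∞⟮I; F, V⟯ →ₗ[C^∞⟮I, M; 𝓘(ℝ, ℝ), ℝ⟯] Cₛ^∞⟮I; F, V⟯) {m : M}
    {u : Cₛ^∞⟮I; F, V⟯} (hu : u m = 0) : Φ u m = 0 := by
  have : ContMDiffVectorBundle 1 F V I := ContMDiffVectorBundle.of_le (n := ∞) (by simp)
  let t := trivializationAt F V m
  have hm : m ∈ t.baseSet := FiberBundle.mem_baseSet_trivializationAt F V m
  let b := Module.finBasis ℝ F
  obtain ⟨ρ, h1, hρ⟩ := exists_smooth_cutoff (I := I) m t.open_baseSet hm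
  let s (i : Fin (Module.finrank ℝ F)) : Cₛ^∞⟮I; F, V⟯ :=
    ⟨_, ContMDiffOn.smul_section_of_tsupport ρ.contMDiff.contMDiffOn t.open_baseSet hρ
      (t.contMDiffOn_localFrame_baseSet ∞ b i)⟩
  have hc (i : Fin (Module.finrank ℝ F)) :
      CMDiff ∞ (fun x ↦ ρ x • t.localFrameCoeff I b i x (u x)) := by
    refine contMDiff_of_tsupport fun x hx ↦ ?_
    have hxt : x ∈ t.baseSet := hρ (tsupport_smul_subset_left _ _ hx)
    exact ρ.contMDiff.contMDiffAt.smul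
      (contMDiffAt_localFrameCoeff b hxt u.contMDiff.contMDiffAt i)
  let c (i : Fin (Module.finrank ℝ F)) : C^∞⟮I, M; 𝓘(ℝ, ℝ), ℝ⟯ := ⟨_, hc i⟩
  have key : (ρ * ρ) • u = ∑ i, c i • s i := by
    ext x
    have hsum : (∑ i, c i • s i : Cₛ^∞⟮I; F, V⟯) x = ∑ i, c i x • s i x := by
      change ContMDiffSection.coeAddHom I F ∞ V (∑ i, c i • s i) x = _
      rw [map_sum, Finset.sum_apply]
      rfl
    rw [hsum]
    change (ρ x * ρ x) • u x = ∑ i, (ρ x • t.localFrameCoeff I b i x (u x)) •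
      (ρ x • t.localFrame b i x)
    by_cases hx : x ∈ t.baseSet
    · conv_lhs => rw [t.eq_sum_localFrameCoeff_smul (I := I) (s := u) (b := b) hx, Finset.smul_sum]
      refine Finset.sum_congr rfl fun i _ ↦ ?_
      simp only [smul_smul, smul_eq_mul]
      congr 1
      ring
    · have : ρ x = 0 := by
        by_contra h
        exact hx (hρ (subset_tsupport _ h))
      simp [this]
  have h2 := congrArg (fun w : Cₛ^∞⟮I; F, V⟯ ↦ w m) (congrArg Φ key)
  have hsum : (∑ i, c i • Φ (s i) : Cₛ^∞⟮I; F, V⟯) m = ∑ i, c i m • Φ (s i) m := by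
    change ContMDiffSection.coeAddHom I F ∞ V (∑ i, c i • Φ (s i)) m = _
    rw [map_sum, Finset.sum_apply]
    rfl
  have hcm (i) : c i m = 0 := by
    change ρ m • t.localFrameCoeff I b i m (u m) = 0
    simp [hu]
  simp only [map_smul, map_sum, hsum, hcm, zero_smul, Finset.sum_const_zero] at h2
  have h3 : (ρ m * ρ m) • Φ u m = 0 := h2
  simpa [h1] using h3

theorem ParaAssociativeAlgebroid.bracket_congr (P : ParaAssociativeAlgebroid I F V) {m : M}
    {u u' v v' w w' : Cₛ^∞⟮I; F, V⟯} (hu : u m = u' m) (hv : v m = v' m) (hw : w m = w' m) :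
    P.bracket u v w m = P.bracket u' v' w' m := by
  have h1 : P.bracket (u - u') v w m = 0 :=
    smoothSection_map_eq_zero ((P.bracket.flip v).flip w) (by simp [hu])
  have h2 : P.bracket u' (v - v') w m = 0 :=
    smoothSection_map_eq_zero ((P.bracket u').flip w) (by simp [hv])
  have h3 : P.bracket u' v' (w - w') m = 0 :=
    smoothSection_map_eq_zero (P.bracket u' v') (by simp [hw])
  simp only [map_sub, LinearMap.sub_apply, ContMDiffSection.coe_sub, Pi.sub_apply,
    sub_eq_zero] at h1 h2 h3
  rw [h1, h2, h3]

/-- The ternary product on the fibre at `m`: `[α, β, γ] = [u, v, w](m)` for smooth sections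
`u`, `v`, `w` through `α`, `β`, `γ`. -/
def ParaAssociativeAlgebroid.fibreBracket (P : ParaAssociativeAlgebroid I F V) (m : M)
    (α β γ : V m) : V m :=
  P.bracket (sectionThrough m α) (sectionThrough m β) (sectionThrough m γ) m

/-- The product on the fibre does not depend on the choice of the sections. -/
theorem ParaAssociativeAlgebroid.fibreBracket_apply (P : ParaAssociativeAlgebroid I F V) (m : M)
    (u v w : Cₛ^∞⟮I; F, V⟯) : P.fibreBracket m (u m) (v m) (w m) = P.bracket u v w m :=
  P.bracket_congr (sectionThrough_apply _ _) (sectionThrough_apply _ _) (sectionThrough_apply _ _)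

theorem ParaAssociativeAlgebroid.fibreBracket_eq (P : ParaAssociativeAlgebroid I F V) {m : M}
    {α β γ : V m} {u v w : Cₛ^∞⟮I; F, V⟯} (hu : u m = α) (hv : v m = β) (hw : w m = γ) :
    P.fibreBracket m α β γ = P.bracket u v w m := by
  subst hu hv hw
  exact P.fibreBracket_apply m u v w

/-- The para-associative algebra structure on the fibre over `m` of a para-associative
algebroid. -/
def ParaAssociativeAlgebroid.fibre (P : ParaAssociativeAlgebroid I F V) (m : M) :
    ParaAssociativeAlgebra ℝ (V m) where
  bracket := LinearMap.mk₂ ℝ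
    (fun α β ↦
      { toFun := fun γ ↦ P.fibreBracket m α β γ
        map_add' := fun γ γ' ↦ by
          have h := sectionThrough_apply (I := I) (F := F) (V := V) m
          rw [P.fibreBracket_eq (h α) (h β)
            (w := sectionThrough m γ + sectionThrough m γ') (by simp [h])]
          simp [fibreBracket]
        map_smul' := fun r γ ↦ by
          have h := sectionThrough_apply (I := I) (F := F) (V := V) m
          rw [P.fibreBracket_eq (h α) (h β)
            (w := (ContMDiffMap.const r : C^∞⟮I, M; 𝓘(ℝ, ℝ), ℝ⟯) • sectionThrough m γ)
            (by rw [smoothSection_smul_apply, h]; rfl)]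
          simp only [map_smul, smoothSection_smul_apply]
          rfl })
    (fun α α' β ↦ by
      ext γ
      have h := sectionThrough_apply (I := I) (F := F) (V := V) m
      change P.fibreBracket m (α + α') β γ = P.fibreBracket m α β γ + P.fibreBracket m α' β γ
      rw [P.fibreBracket_eq (u := sectionThrough m α + sectionThrough m α') (by simp [h])
        (h β) (h γ)]
      simp [fibreBracket])
    (fun r α β ↦ by
      ext γ
      have h := sectionThrough_apply (I := I) (F := F) (V := V) m
      change P.fibreBracket m (r • α) β γ = r • P.fibreBracket m α β γ
      rw [P.fibreBracket_eq
        (u := (ContMDiffMap.const r : C^∞⟮I, M; 𝓘(ℝ, ℝ), ℝ⟯) • sectionThrough m α)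
        (by rw [smoothSection_smul_apply, h]; rfl) (h β) (h γ)]
      simp only [map_smul, LinearMap.smul_apply, smoothSection_smul_apply]
      rfl)
    (fun α β β' ↦ by
      ext γ
      have h := sectionThrough_apply (I := I) (F := F) (V := V) m
      change P.fibreBracket m α (β + β') γ = P.fibreBracket m α β γ + P.fibreBracket m α β' γ
      rw [P.fibreBracket_eq (v := sectionThrough m β + sectionThrough m β') (h α) (by simp [h])
        (h γ)]
      simp [fibreBracket])
    (fun r α β ↦ by
      ext γ
      have h := sectionThrough_apply (I := I) (F := F) (V := V) m
      change P.fibreBracket m α (r • β) γ = r • P.fibreBracket m α β γ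
      rw [P.fibreBracket_eq
        (v := (ContMDiffMap.const r : C^∞⟮I, M; 𝓘(ℝ, ℝ), ℝ⟯) • sectionThrough m β)
        (h α) (by rw [smoothSection_smul_apply, h]; rfl) (h γ)]
      simp only [map_smul, LinearMap.smul_apply, smoothSection_smul_apply]
      rfl)
  para_left α₁ α₂ α₃ α₄ α₅ := by
    have h := sectionThrough_apply (I := I) (F := F) (V := V) m
    change P.fibreBracket m (P.fibreBracket m α₁ α₂ α₃) α₄ α₅
      = P.fibreBracket m α₁ (P.fibreBracket m α₄ α₃ α₂) α₅
    rw [P.fibreBracket_eq (P.fibreBracket_eq (h α₁) (h α₂) (h α₃)).symm (h α₄) (h α₅),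
      P.fibreBracket_eq (h α₁) (P.fibreBracket_eq (h α₄) (h α₃) (h α₂)).symm (h α₅),
      P.para_left]
  para_right α₁ α₂ α₃ α₄ α₅ := by
    have h := sectionThrough_apply (I := I) (F := F) (V := V) m
    change P.fibreBracket m α₁ (P.fibreBracket m α₄ α₃ α₂) α₅
      = P.fibreBracket m α₁ α₂ (P.fibreBracket m α₃ α₄ α₅)
    rw [P.fibreBracket_eq (h α₁) (P.fibreBracket_eq (h α₄) (h α₃) (h α₂)).symm (h α₅),
      P.fibreBracket_eq (h α₁) (h α₂) (P.fibreBracket_eq (h α₃) (h α₄) (h α₅)).symm,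
      P.para_right]

theorem ParaAssociativeAlgebroid.fibre_bracket_apply (P : ParaAssociativeAlgebroid I F V) (m : M)
    (u v w : Cₛ^∞⟮I; F, V⟯) : (P.fibre m).bracket (u m) (v m) (w m) = P.bracket u v w m :=
  P.fibreBracket_apply m u v w

end Fibres

section Bundles

universe uF

variable {E : Type*} [NormedAddCommGroup E] [NormedSpace ℝ E]
  {H : Type*} [TopologicalSpace H] (I : ModelWithCorners ℝ E H)
  {M : Type*} [TopologicalSpace M] [ChartedSpace H M]
  {F : Type uF} [NormedAddCommGroup F] [NormedSpace ℝ F]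
  {V : M → Type*} [TopologicalSpace (TotalSpace F V)]
  [∀ x, AddCommGroup (V x)] [∀ x, Module ℝ (V x)] [∀ x, TopologicalSpace (V x)]
  [FiberBundle F V] [VectorBundle ℝ F V]

/-- The vector bundle `V`, with a para-associative algebra structure `Q m` on each fibre, is a
*para-associative algebra bundle*: around each point there are an open set `U`, a para-associative
algebra `A` and a fibre-preserving diffeomorphism `ψ : π⁻¹(U) → U × A` (here a
`Trivialization` with base set `U`, smooth in both directions) that restricts to an isomorphism of
para-associative algebras on each fibre over `U`. The norm on the finite-dimensional space `A`
only serves to give `A` its standard smooth structure. -/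
def IsParaAssociativeAlgebraBundle (Q : ∀ m, ParaAssociativeAlgebra ℝ (V m)) : Prop :=
  ∀ m : M, ∃ (A : Type uF) (_ : NormedAddCommGroup A) (_ : NormedSpace ℝ A)
    (_ : FiniteDimensional ℝ A) (R : ParaAssociativeAlgebra ℝ A)
    (ψ : Trivialization A (TotalSpace.proj : TotalSpace F V → M)),
    m ∈ ψ.baseSet ∧
    ContMDiffOn (I.prod 𝓘(ℝ, F)) (I.prod 𝓘(ℝ, A)) ∞ ψ ψ.source ∧
    ContMDiffOn (I.prod 𝓘(ℝ, A)) (I.prod 𝓘(ℝ, F)) ∞ ψ.toOpenPartialHomeomorph.symm ψ.target ∧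
    ∀ n ∈ ψ.baseSet, ∃ φ : V n ≃ₗ[ℝ] A,
      (∀ α : V n, (ψ (TotalSpace.mk n α)).2 = φ α) ∧ (Q n).IsIso R φ

end Bundles

section Connections

variable {E : Type*} [NormedAddCommGroup E] [NormedSpace ℝ E]
  {H : Type*} [TopologicalSpace H] {I : ModelWithCorners ℝ E H}
  {M : Type*} [TopologicalSpace M] [ChartedSpace H M] [IsManifold I ∞ M]
  {F : Type*} [NormedAddCommGroup F] [NormedSpace ℝ F]
  {V : M → Type*} [TopologicalSpace (TotalSpace F V)]
  [∀ x, AddCommGroup (V x)] [∀ x, Module ℝ (V x)] [∀ x, TopologicalSpace (V x)]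
  [∀ x, IsTopologicalAddGroup (V x)] [∀ x, ContinuousSMul ℝ (V x)]
  [FiberBundle F V] [VectorBundle ℝ F V]

/-- For a smooth linear connection `D`, the smooth section `∇_X u`. -/
def smoothCovDeriv (D : CovariantDerivative I F V) [hD : D.ContMDiffCovariantDerivative ∞]
    (X : Cₛ^∞⟮I; E, (TangentSpace I : M → Type _)⟯) (u : Cₛ^∞⟮I; F, V⟯) : Cₛ^∞⟮I; F, V⟯ where
  toFun x := D u x (X x)
  contMDiff_toFun := by
    have hu : CMDiff[Set.univ] ((∞ : ℕ∞ω) + 1) (T% fun x ↦ u x) := by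
      simpa using! u.contMDiff.contMDiffOn
    have h := contMDiffOn_univ.1 (hD.contMDiff.contMDiff hu)
    exact fun x ↦ ContMDiffAt.clm_bundle_apply (b := fun x : M ↦ x) (h x) (X.contMDiff x)

/-- A *differential connection* on a para-associative algebroid: a smooth linear connection with
`∇_X [u, v, w] = [∇_X u, v, w] + [u, ∇_X v, w] + [u, v, ∇_X w]`. -/
structure IsDifferentialConnection (P : ParaAssociativeAlgebroid I F V)
    (D : CovariantDerivative I F V) : Prop where
  smooth : D.ContMDiffCovariantDerivative ∞
  leibniz : ∀ (X : Cₛ^∞⟮I; E, (TangentSpace I : M → Type _)⟯) (u v w : Cₛ^∞⟮I; F, V⟯),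
    smoothCovDeriv D X (P.bracket u v w) =
      P.bracket (smoothCovDeriv D X u) v w + P.bracket u (smoothCovDeriv D X v) w +
        P.bracket u v (smoothCovDeriv D X w)

end Connections

end

/-! From local triviality to a connection: an algebra trivialization `ψ` carries the flat connection
for which `ψ`-constant sections are parallel. The product does not vary in this trivialization, so
the Leibniz identity is the ordinary product rule for a fixed trilinear map (`flatCov_bracket`).
Both conditions survive averaging: a weighted sum of connections with weights summing to `1` is a
connection, and the Leibniz identity is linear in the connection. A smooth partition of unity
therefore glues the flat connections.

From a connection to local triviality: the Leibniz identity says that the product is a parallel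
tensor, so parallel transport along any curve is an isomorphism between the algebras at its ends. In
a chart and a vector bundle trivialization near `m`, where `∇ = d + A`, transport along the rays
from `m` identifies each nearby fibre with the fibre at `m`
(`IsDifferentialConnection.fderiv_localBracket`, `rayTransport_trilinear`). The model algebra is the
fibre at `m`.

The analytic point is that ray transport depends smoothly on the endpoint `y`. The transport
equation is written as `f + V_y f = a` in the Banach space of continuous curves on the unit
interval, with `V_y` the Volterra operator of `A` along the ray. The operator `V_y` is smooth in `y`
(`contDiff_onRay`), inversion of operators is smooth, and `V_0 = 0`; hence for `y` near `0` the
solution exists, is unique and varies smoothly. -/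

noncomputable section RayTransport

open Set unitInterval MeasureTheory

/-! ### Product rules for families of multilinear maps -/

section

variable {F G : Type*} [NormedAddCommGroup F] [NormedSpace ℝ F] [FiniteDimensional ℝ F]
  [NormedAddCommGroup G] [NormedSpace ℝ G]

/-- In a finite basis the value is a finite sum of coordinates of `f x` times the values of `q x` on
basis vectors, so continuity for each fixed argument suffices. -/
theorem LinearMap.continuous_apply_of_pointwise {X : Type*} [TopologicalSpace X]
    {q : X → F →ₗ[ℝ] G} (hq : ∀ a, Continuous fun x ↦ q x a) {f : X → F} (hf : Continuous f) :
    Continuous fun x ↦ q x (f x) := by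
  let b := Module.finBasis ℝ F
  have h (x : X) : q x (f x) = ∑ i, b.repr (f x) i • q x (b i) := by
    conv_lhs => rw [← b.sum_repr (f x), map_sum]
    simp
  simp only [h]
  have hb (i) : Continuous fun x ↦ b.repr (f x) i :=
    (b.coord i).continuous_of_finiteDimensional.comp hf
  exact continuous_finsetSum _ fun i _ ↦ (hb i).smul (hq _)

theorem LinearMap.continuous_trilinear {X : Type*} [TopologicalSpace X]
    {c : X → F →ₗ[ℝ] F →ₗ[ℝ] F →ₗ[ℝ] G} (hc : ∀ a₁ a₂ a₃, Continuous fun x ↦ c x a₁ a₂ a₃)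
    {f₁ f₂ f₃ : X → F} (h₁ : Continuous f₁) (h₂ : Continuous f₂) (h₃ : Continuous f₃) :
    Continuous fun x ↦ c x (f₁ x) (f₂ x) (f₃ x) :=
  continuous_apply_of_pointwise (q := fun x ↦ c x (f₁ x) (f₂ x)) (fun a₃ ↦
    continuous_apply_of_pointwise (q := fun x ↦ (c x (f₁ x)).flip a₃) (fun a₂ ↦
      continuous_apply_of_pointwise (q := fun x ↦ ((c x).flip a₂).flip a₃)
        (fun a₁ ↦ hc a₁ a₂ a₃) h₁) h₂) h₃

theorem LinearMap.hasDerivAt_apply_of_pointwise {q : ℝ → F →ₗ[ℝ] G} {q' : F → G} {t : ℝ}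
    (hq : ∀ a, HasDerivAt (fun s ↦ q s a) (q' a) t) {f : ℝ → F} {f' : F} (hf : HasDerivAt f f' t) :
    HasDerivAt (fun s ↦ q s (f s)) (q' (f t) + q t f') t := by
  let b := Module.finBasis ℝ F
  have h (s : ℝ) (a : F) : q s a = ∑ i, b.coord i a • q s (b i) := by
    conv_lhs => rw [← b.sum_repr a, map_sum]
    simp
  have hb (i) : HasDerivAt (fun s ↦ b.coord i (f s)) (b.coord i f') t :=
    (b.coord i).toContinuousLinearMap.hasFDerivAt.comp_hasDerivAt t hf
  have hd := HasDerivAt.fun_sum (u := Finset.univ) fun i _ ↦ (hb i).smul (hq (b i))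
  -- Linearity of `q'` is not assumed; uniqueness of derivatives forces its expansion in the basis.
  have h' : q' (f t) = ∑ i, b.coord i (f t) • q' (b i) := by
    refine (hq (f t)).unique ?_
    simp only [h _ (f t)]
    exact HasDerivAt.fun_sum fun i _ ↦ (hq (b i)).const_smul _
  rw [h', h t f', ← Finset.sum_add_distrib]
  simp only [h _ (f _)]
  exact hd

theorem LinearMap.hasDerivAt_trilinear {c : ℝ → F →ₗ[ℝ] F →ₗ[ℝ] F →ₗ[ℝ] G} {c' : F → F → F → G}
    {t : ℝ} (hc : ∀ a₁ a₂ a₃, HasDerivAt (fun s ↦ c s a₁ a₂ a₃) (c' a₁ a₂ a₃) t)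
    {f₁ f₂ f₃ : ℝ → F} {f₁' f₂' f₃' : F} (h₁ : HasDerivAt f₁ f₁' t) (h₂ : HasDerivAt f₂ f₂' t)
    (h₃ : HasDerivAt f₃ f₃' t) :
    HasDerivAt (fun s ↦ c s (f₁ s) (f₂ s) (f₃ s)) (c' (f₁ t) (f₂ t) (f₃ t) +
      c t f₁' (f₂ t) (f₃ t) + c t (f₁ t) f₂' (f₃ t) + c t (f₁ t) (f₂ t) f₃') t :=
  hasDerivAt_apply_of_pointwise (q := fun s ↦ c s (f₁ s) (f₂ s))
    (q' := fun a₃ ↦ c' (f₁ t) (f₂ t) a₃ + c t f₁' (f₂ t) a₃ + c t (f₁ t) f₂' a₃) (fun a₃ ↦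
    hasDerivAt_apply_of_pointwise (q := fun s ↦ (c s (f₁ s)).flip a₃)
      (q' := fun a₂ ↦ c' (f₁ t) a₂ a₃ + c t f₁' a₂ a₃) (fun a₂ ↦
      hasDerivAt_apply_of_pointwise (q := fun s ↦ ((c s).flip a₂).flip a₃)
        (q' := fun a₁ ↦ c' a₁ a₂ a₃) (fun a₁ ↦ hc a₁ a₂ a₃) h₁) h₂) h₃

end

/-! ### Smooth operations on spaces of continuous functions -/

section

variable {K Y Z W : Type*} [TopologicalSpace K] [CompactSpace K]
    [NormedAddCommGroup Z] [NormedSpace ℝ Z] [NormedAddCommGroup W] [NormedSpace ℝ W]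
    [NormedAddCommGroup Y] [NormedSpace ℝ Y]

variable (K) in
/-- The bilinear map on spaces of continuous functions induced by a bilinear map. -/
def ContinuousMap.bilinear (β : Y →L[ℝ] Z →L[ℝ] W) : C(K, Y) →L[ℝ] C(K, Z) →L[ℝ] C(K, W) :=
  LinearMap.mkContinuous₂
    (LinearMap.mk₂ ℝ (fun (f : C(K, Y)) (g : C(K, Z)) ↦
        (⟨fun t ↦ β (f t) (g t), by fun_prop⟩ : C(K, W)))
      (fun _ _ _ ↦ by ext; simp) (fun _ _ _ ↦ by ext; simp)
      (fun _ _ _ ↦ by ext; simp) (fun _ _ _ ↦ by ext; simp)) ‖β‖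
    (fun f g ↦ by
      refine (ContinuousMap.norm_le _ (by positivity)).2 fun t ↦ ?_
      refine (β.le_opNorm₂ (f t) (g t)).trans ?_
      gcongr
      · exact f.norm_coe_le_norm t
      · exact g.norm_coe_le_norm t)

@[simp]
theorem ContinuousMap.bilinear_apply (β : Y →L[ℝ] Z →L[ℝ] W) (f : C(K, Y)) (g : C(K, Z)) (t : K) :
    ContinuousMap.bilinear K β f g t = β (f t) (g t) := rfl

theorem ContDiff.continuousMapBilinear {X : Type*} [NormedAddCommGroup X] [NormedSpace ℝ X]
    {n : ℕ∞ω} (β : Y →L[ℝ] Z →L[ℝ] W) {f : X → C(K, Y)} (hf : ContDiff ℝ n f) :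
    ContDiff ℝ n fun x ↦ ContinuousMap.bilinear K β (f x) := by
  have h := (ContinuousMap.bilinear K β).contDiff (n := n)
  exact h.comp hf

theorem ContDiff.continuousMapBilinear_comp {X V : Type*} [NormedAddCommGroup X] [NormedSpace ℝ X]
    [NormedAddCommGroup V] [NormedSpace ℝ V] {n : ℕ∞ω} (β : Y →L[ℝ] Z →L[ℝ] W) {f : X → C(K, Y)}
    (hf : ContDiff ℝ n f) (ρ : V →L[ℝ] C(K, Z)) :
    ContDiff ℝ n fun x ↦ (ContinuousMap.bilinear K β (f x)).comp ρ := by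
  have h := hf.continuousMapBilinear β
  exact h.clm_comp contDiff_const

theorem ContDiff.comp_continuousMapBilinear {X V : Type*} [NormedAddCommGroup X] [NormedSpace ℝ X]
    [NormedAddCommGroup V] [NormedSpace ℝ V] {n : ℕ∞ω} (β : Y →L[ℝ] Z →L[ℝ] W) {f : X → C(K, Y)}
    (hf : ContDiff ℝ n f) (ρ : C(K, W) →L[ℝ] V) :
    ContDiff ℝ n fun x ↦ ρ.comp (ContinuousMap.bilinear K β (f x)) := by
  have h := hf.continuousMapBilinear β
  exact contDiff_const.clm_comp h

theorem ContDiff.continuousMapBilinear_apply {X : Type*} [NormedAddCommGroup X] [NormedSpace ℝ X]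
    {n : ℕ∞ω} (β : Y →L[ℝ] Z →L[ℝ] W) {f : X → C(K, Y)} (hf : ContDiff ℝ n f) {g : X → C(K, Z)}
    (hg : ContDiff ℝ n g) : ContDiff ℝ n fun x ↦ ContinuousMap.bilinear K β (f x) (g x) := by
  have h := hf.continuousMapBilinear β
  exact h.clm_apply hg

/-- The space of continuous linear maps, with only the structure derived from its norm. -/
def OpSpace (Z W : Type*) [NormedAddCommGroup Z] [NormedSpace ℝ Z] [NormedAddCommGroup W]
    [NormedSpace ℝ W] : Type _ := Z →L[ℝ] W

instance : NormedAddCommGroup (OpSpace Z W) := inferInstanceAs (NormedAddCommGroup (Z →L[ℝ] W))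
instance : NormedSpace ℝ (OpSpace Z W) := inferInstanceAs (NormedSpace ℝ (Z →L[ℝ] W))

variable (Z W) in
/-- Evaluation of operators, as a continuous bilinear map. -/
def OpSpace.apply : OpSpace Z W →L[ℝ] Z →L[ℝ] W := ContinuousLinearMap.id ℝ (Z →L[ℝ] W)

variable (Z W) in
/-- A continuous linear map as an element of `OpSpace`. -/
def OpSpace.of : (Z →L[ℝ] W) →L[ℝ] OpSpace Z W := ContinuousLinearMap.id ℝ (Z →L[ℝ] W)

@[simp]
theorem OpSpace.apply_of (f : Z →L[ℝ] W) : OpSpace.apply Z W (OpSpace.of Z W f) = f := rfl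

end

theorem contDiffOn_ringInverse_one_add {Y X : Type*} [NormedAddCommGroup Y] [NormedSpace ℝ Y]
    [NormedAddCommGroup X] [NormedSpace ℝ X] [CompleteSpace X] {n : ℕ∞ω} {k : Y → X →L[ℝ] X}
    (hk : ContDiff ℝ n k) :
    ContDiffOn ℝ n (fun y ↦ Ring.inverse (1 + k y)) {y | IsUnit (1 + k y)} := by
  rintro y ⟨u, hu⟩
  have h : ContDiffAt ℝ n Ring.inverse (u : X →L[ℝ] X) := contDiffAt_ringInverse ℝ u
  rw [hu] at h
  exact (h.comp y (contDiff_const.add hk).contDiffAt).contDiffWithinAt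

theorem isOpen_setOf_isUnit_one_add {Y X : Type*} [TopologicalSpace Y]
    [NormedAddCommGroup X] [NormedSpace ℝ X] [CompleteSpace X] {k : Y → X →L[ℝ] X}
    (hk : Continuous k) : IsOpen {y | IsUnit (1 + k y)} :=
  Units.isOpen.preimage (continuous_const.add hk)

/-- Integration from `0`, on continuous functions on the unit interval. -/
def unitIntegralL (F : Type*) [NormedAddCommGroup F] [NormedSpace ℝ F] :
    C(I, F) →L[ℝ] C(I, F) :=
  LinearMap.mkContinuous
    { toFun := fun f ↦ ⟨fun t ↦ ∫ s in (0 : ℝ)..t, f (projIcc 0 1 zero_le_one s), by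
        have h : Continuous fun s ↦ f (projIcc (0 : ℝ) 1 zero_le_one s) := by fun_prop
        exact (intervalIntegral.continuous_primitive (fun a b ↦ h.intervalIntegrable a b) 0).comp
          continuous_subtype_val⟩
      map_add' := fun f g ↦ by
        ext t
        exact intervalIntegral.integral_add
          (Continuous.intervalIntegrable (by fun_prop) _ _)
          (Continuous.intervalIntegrable (by fun_prop) _ _)
      map_smul' := fun r f ↦ by
        ext t
        exact intervalIntegral.integral_smul r _ } 1
    (fun f ↦ by
      rw [one_mul, ContinuousMap.norm_le _ (norm_nonneg _)]
      intro t
      refine (intervalIntegral.norm_integral_le_of_norm_le_const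
        (fun s _ ↦ f.norm_coe_le_norm _)).trans ?_
      rw [sub_zero, abs_of_nonneg t.2.1]
      exact mul_le_of_le_one_right (norm_nonneg _) t.2.2)

/-! ### Smoothness of restriction to rays -/

section Rays

variable {E : Type} [NormedAddCommGroup E] [NormedSpace ℝ E]

/-- The ray `t ↦ t • y`, for `t` in the unit interval, depending linearly on `y`. -/
def rayL (E : Type) [NormedAddCommGroup E] [NormedSpace ℝ E] : E →L[ℝ] C(I, E) :=
  LinearMap.mkContinuous
    { toFun := fun y ↦ ⟨fun t ↦ (t : ℝ) • y, by fun_prop⟩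
      map_add' := fun y z ↦ by ext t; exact smul_add _ _ _
      map_smul' := fun r y ↦ by ext t; exact smul_comm _ _ _ } 1
    (fun y ↦ by
      rw [one_mul, ContinuousMap.norm_le _ (norm_nonneg _)]
      intro t
      change ‖(t : ℝ) • y‖ ≤ ‖y‖
      rw [norm_smul, Real.norm_of_nonneg t.2.1]
      exact mul_le_of_le_one_left (norm_nonneg _) t.2.2)

@[simp]
theorem rayL_apply (y : E) (t : I) : rayL E y t = (t : ℝ) • y := rfl

/-- Restriction of a continuous function to the rays from the origin. -/
def onRay {Z : Type*} [TopologicalSpace Z] (h : C(E, Z)) (y : E) : C(I, Z) := h.comp (rayL E y)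

@[simp]
theorem onRay_apply {Z : Type*} [TopologicalSpace Z] (h : C(E, Z)) (y : E) (t : I) :
    onRay h y t = h ((t : ℝ) • y) := rfl

/-- The mean value inequality bounds the remainder at time `t` by the oscillation of `h'` on a ball
around `t • y`. Uniform continuity gives one radius for all `t`, hence an estimate in the supremum
norm. -/
theorem hasFDerivAt_onRay {Z : Type*} [NormedAddCommGroup Z] [NormedSpace ℝ Z] {h : C(E, Z)}
    {h' : C(E, OpSpace E Z)} (hh : ∀ y, HasFDerivAt h (OpSpace.apply E Z (h' y)) y) (hu :
      UniformContinuous h') (y : E) :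
    HasFDerivAt (onRay h)
      ((ContinuousMap.bilinear I (OpSpace.apply E Z) (onRay h' y)).comp (rayL E)) y := by
  rw [hasFDerivAt_iff_isLittleO_nhds_zero, Asymptotics.isLittleO_iff]
  intro ε hε
  obtain ⟨δ, hδ, H⟩ := Metric.uniformContinuous_iff.1 hu ε hε
  filter_upwards [Metric.ball_mem_nhds (0 : E) hδ] with v hv
  rw [ContinuousMap.norm_le _ (by positivity)]
  intro t
  change ‖h ((t : ℝ) • (y + v)) - h ((t : ℝ) • y) - OpSpace.apply E Z (h' ((t : ℝ) • y)) ((t :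
    ℝ) • v)‖ ≤ _
  have hle : ‖(t : ℝ) • v‖ ≤ ‖v‖ := by
    rw [norm_smul, Real.norm_of_nonneg t.2.1]
    exact mul_le_of_le_one_left (norm_nonneg _) t.2.2
  have hv' : ‖(t : ℝ) • v‖ < δ := hle.trans_lt (by simpa using hv)
  have key := (convex_ball ((t : ℝ) • y) δ).norm_image_sub_le_of_norm_hasFDerivWithin_le'
    (f := h) (f' := fun z ↦ OpSpace.apply E Z (h' z)) (φ := OpSpace.apply E Z (h' ((t : ℝ) • y)))
      (C := ε)
    (x := (t : ℝ) • y) (y := (t : ℝ) • (y + v)) (fun z _ ↦ (hh z).hasFDerivWithinAt)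
    (fun z hz ↦ (dist_eq_norm (h' z) (h' ((t : ℝ) • y))).symm.trans_le (H hz).le)
      (Metric.mem_ball_self hδ)
    (mem_ball_iff_norm.2 (by rw [← smul_sub, add_sub_cancel_left]; exact hv'))
  rw [← smul_sub, add_sub_cancel_left] at key
  exact key.trans (mul_le_mul_of_nonneg_left hle hε.le)

/-- The derivative of `onRay h` is built from `onRay h'` by fixed continuous linear operations, so
order `n` for `h'` gives order `n + 1` for `h`. The target space changes at each step of the
induction; compact support supplies the uniform continuity. -/
theorem contDiff_onRay {Z : Type*} [NormedAddCommGroup Z] [NormedSpace ℝ Z] {h : C(E, Z)}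
    (hh : ContDiff ℝ ∞ h) (hc : HasCompactSupport h) : ContDiff ℝ ∞ (onRay h) := by
  refine contDiff_infty.2 fun n ↦ ?_
  induction n generalizing Z with
  | zero =>
    refine contDiff_zero.2 (ContinuousMap.continuous_of_continuous_uncurry _ ?_)
    change Continuous fun p : E × I ↦ h ((p.2 : ℝ) • p.1)
    fun_prop
  | succ n ih =>
    let h' : C(E, OpSpace E Z) :=
      ⟨fun y ↦ OpSpace.of E Z (fderiv ℝ h y), (OpSpace.of E Z).continuous.comp
        (hh.continuous_fderiv (by simp))⟩
    have hc' : HasCompactSupport h' := (hc.fderiv (𝕜 := ℝ)).comp_left (g := OpSpace.of E Z)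
      (map_zero _)
    have hh' : ContDiff ℝ ∞ h' :=
      (OpSpace.of E Z).contDiff.comp (hh.fderiv_right (m := ∞) (by simp))
    rw [show ((n + 1 : ℕ) : ℕ∞ω) = (n : ℕ∞ω) + 1 by norm_cast]
    refine contDiff_succ_iff_hasFDerivAt.2 ⟨_, ?_, hasFDerivAt_onRay (h' := h')
      (fun y ↦ (hh.differentiable (by simp) y).hasFDerivAt)
      (hc'.uniformContinuous_of_continuous h'.continuous)⟩
    exact (ih hh' hc').continuousMapBilinear_comp _ _

end Rays

/-! ### Parallel transport along rays through the Volterra equation -/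

section Transport

variable {E : Type} [NormedAddCommGroup E] [NormedSpace ℝ E]
  {F : Type*} [NormedAddCommGroup F] [NormedSpace ℝ F]
  {A : C(E, OpSpace E (OpSpace F F))} {y : E}

/-- The connection matrix `A`, evaluated along the ray to `y` on the velocity of the ray. -/
def rayMatrix (A : C(E, OpSpace E (OpSpace F F))) (y : E) : C(I, OpSpace F F) :=
  ContinuousMap.bilinear I (OpSpace.apply E (OpSpace F F)) (onRay A y) (ContinuousMap.const I y)

@[simp]
theorem rayMatrix_apply (A : C(E, OpSpace E (OpSpace F F))) (y : E) (t : I) :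
    rayMatrix A y t = OpSpace.apply E (OpSpace F F) (A ((t : ℝ) • y)) y := rfl

/-- The Volterra operator of the equation of parallel transport along the ray to `y`. -/
def rayVolterra (A : C(E, OpSpace E (OpSpace F F))) (y : E) : C(I, F) →L[ℝ] C(I, F) :=
  (unitIntegralL F).comp (ContinuousMap.bilinear I (OpSpace.apply F F) (rayMatrix A y))

/-- Parallel transport along the rays from the origin, as long as the equation of parallel
transport is solved by inverting the operator `1 + rayVolterra A y`. -/
def rayParallel (A : C(E, OpSpace E (OpSpace F F))) (y : E) : F →L[ℝ] C(I, F) :=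
  (Ring.inverse (1 + rayVolterra A y) : C(I, F) →L[ℝ] C(I, F)).comp (ContinuousLinearMap.const ℝ I)

theorem rayVolterra_apply (A : C(E, OpSpace E (OpSpace F F))) (y : E) (f : C(I, F)) (t : I) :
    rayVolterra A y f t = ∫ s in (0 : ℝ)..t,
      OpSpace.apply F F (rayMatrix A y (projIcc 0 1 zero_le_one s)) (f
        (projIcc 0 1 zero_le_one s)) := rfl

theorem rayVolterra_zero (A : C(E, OpSpace E (OpSpace F F))) : rayVolterra A 0 = 0 := by
  ext f t
  rw [rayVolterra_apply]
  simp

theorem eq_rayParallel (h : IsUnit (1 + rayVolterra A y)) {a : F} {f : C(I, F)}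
    (hf : f + rayVolterra A y f = ContinuousMap.const I a) : f = rayParallel A y a := by
  have h1 := DFunLike.congr_fun (Ring.inverse_mul_cancel _ h) f
  change Ring.inverse (1 + rayVolterra A y) (f + rayVolterra A y f) = f at h1
  rw [← h1, hf]
  rfl

theorem rayParallel_add (h : IsUnit (1 + rayVolterra A y)) (a : F) :
    rayParallel A y a + rayVolterra A y (rayParallel A y a) = ContinuousMap.const I a :=
  DFunLike.congr_fun (Ring.mul_inverse_cancel _ h) (ContinuousMap.const I a)

theorem rayParallel_apply_zero (h : IsUnit (1 + rayVolterra A y)) (a : F) :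
    rayParallel A y a 0 = a := by
  have := DFunLike.congr_fun (rayParallel_add h a) (0 : I)
  simpa [rayVolterra_apply] using this

variable [CompleteSpace F]

/-- The fundamental theorem of calculus, applied to the integral equation. Times are interior
because `projIcc` freezes the curve outside the unit interval. -/
theorem hasDerivAt_rayParallel (h : IsUnit (1 + rayVolterra A y)) (a : F) {t : ℝ}
    (ht : t ∈ Ioo (0 : ℝ) 1) :
    HasDerivAt (fun s ↦ rayParallel A y a (projIcc 0 1 zero_le_one s))
      (-OpSpace.apply F F (OpSpace.apply E _ (A (t • y)) y) (rayParallel A y a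
        (projIcc 0 1 zero_le_one t))) t := by
  let k (s : ℝ) : F := OpSpace.apply F F (rayMatrix A y (projIcc 0 1 zero_le_one s))
    (rayParallel A y a (projIcc 0 1 zero_le_one s))
  have hk : Continuous k := by fun_prop
  have h1 : HasDerivAt (fun s ↦ a - ∫ r in (0 : ℝ)..s, k r) (-k t) t :=
    (intervalIntegral.integral_hasDerivAt_right (hk.intervalIntegrable _ _)
      (hk.stronglyMeasurableAtFilter _ _) hk.continuousAt).const_sub a
  have h2 : k t = OpSpace.apply F F (OpSpace.apply E _ (A (t • y)) y) (rayParallel A y a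
    (projIcc 0 1 zero_le_one t)) := by
    simp only [k, rayMatrix_apply, projIcc_of_mem zero_le_one (Ioo_subset_Icc_self ht)]
  rw [← h2]
  refine h1.congr_of_eventuallyEq ?_
  filter_upwards [Ioo_mem_nhds ht.1 ht.2] with s hs
  rw [projIcc_of_mem zero_le_one (Ioo_subset_Icc_self hs), eq_sub_iff_add_eq]
  exact DFunLike.congr_fun (rayParallel_add h a) ⟨s, Ioo_subset_Icc_self hs⟩

/-- A curve over the ray to `y` which solves the equation of parallel transport is the parallel
transport of its initial value. -/
theorem eq_rayParallel_of_hasDerivAt (h : IsUnit (1 + rayVolterra A y)) {w : C(I, F)}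
    (hw : ∀ t ∈ Ioo (0 : ℝ) 1, HasDerivAt (fun s ↦ w (projIcc 0 1 zero_le_one s))
      (-OpSpace.apply F F (OpSpace.apply E _ (A (t • y)) y) (w (projIcc 0 1 zero_le_one t))) t) :
        w = rayParallel A y (w 0) := by
  refine eq_rayParallel h ?_
  ext t
  let k (s : ℝ) : F := OpSpace.apply F F (rayMatrix A y (projIcc 0 1 zero_le_one s)) (w
    (projIcc 0 1 zero_le_one s))
  have hk : Continuous k := by fun_prop
  have key := intervalIntegral.integral_eq_sub_of_hasDerivAt_of_le t.2.1
    (f := fun s ↦ w (projIcc 0 1 zero_le_one s)) (f' := fun s ↦ -k s)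
    (by fun_prop) (fun s hs ↦ by
      have hs' : s ∈ Ioo (0 : ℝ) 1 := ⟨hs.1, hs.2.trans_le t.2.2⟩
      have := hw s hs'
      simpa only [k, rayMatrix_apply, projIcc_of_mem zero_le_one
        (Ioo_subset_Icc_self hs')] using this)
    (hk.neg.intervalIntegrable _ _)
  simp only [intervalIntegral.integral_neg, projIcc_val, projIcc_left] at key
  change w t + ∫ s in (0 : ℝ)..t, k s = w 0
  rw [← neg_neg (∫ s in (0 : ℝ)..t, k s), key]
  abel

omit [CompleteSpace F] in
theorem contDiff_rayVolterra (hA : ContDiff ℝ ∞ A) (hc : HasCompactSupport A) :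
    ContDiff ℝ ∞ (rayVolterra A) := by
  have h1 : ContDiff ℝ ∞ (rayMatrix A) :=
    (contDiff_onRay hA hc).continuousMapBilinear_apply (OpSpace.apply E (OpSpace F F))
      (ContinuousLinearMap.const ℝ I : E →L[ℝ] C(I, E)).contDiff
  exact h1.comp_continuousMapBilinear (OpSpace.apply F F) (unitIntegralL F)

theorem contDiffOn_rayParallel (hA : ContDiff ℝ ∞ A) (hc : HasCompactSupport A) :
    ContDiffOn ℝ ∞ (rayParallel A) {y | IsUnit (1 + rayVolterra A y)} := by
  have h := contDiffOn_ringInverse_one_add (contDiff_rayVolterra hA hc)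
  exact h.clm_comp contDiffOn_const

/-- Parallel transport from the origin to `y` along the ray. -/
def rayTransport (A : C(E, OpSpace E (OpSpace F F))) (y : E) : F →L[ℝ] F :=
  (ContinuousMap.evalCLM ℝ 1).comp (rayParallel A y)

omit [CompleteSpace F] in
theorem rayTransport_zero (A : C(E, OpSpace E (OpSpace F F))) : rayTransport A 0 = 1 := by
  have h : IsUnit (1 + rayVolterra A 0) := by simp [rayVolterra_zero]
  ext a
  have h1 := DFunLike.congr_fun (rayParallel_add h a) 1
  simpa [rayVolterra_zero] using! h1

theorem contDiffOn_rayTransport (hA : ContDiff ℝ ∞ A) (hc : HasCompactSupport A) :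
    ContDiffOn ℝ ∞ (rayTransport A) {y | IsUnit (1 + rayVolterra A y)} := by
  have h := contDiffOn_rayParallel hA hc
  exact contDiffOn_const.clm_comp h

theorem isOpen_setOf_isUnit_rayVolterra (hA : ContDiff ℝ ∞ A) (hc : HasCompactSupport A) :
    IsOpen {y | IsUnit (1 + rayVolterra A y)} :=
  isOpen_setOf_isUnit_one_add (contDiff_rayVolterra hA hc).continuous

/-- The hypothesis `hcA` says that `c` is parallel for `d + A`. Along the ray, the product `w` of
three parallel curves satisfies the transport equation: the terms of `hcA` with `A` inside an
argument cancel against the derivatives of the curves. By uniqueness `w` is the transport of its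
initial value `c 0 a₁ a₂ a₃`; the claim is the value at time `1`. -/
theorem rayTransport_trilinear [FiniteDimensional ℝ F] {U : Set E} (hU : StarConvex ℝ 0 U)
    {c : E → F →ₗ[ℝ] F →ₗ[ℝ] F →ₗ[ℝ] F}
    (hc : ∀ a₁ a₂ a₃, ∀ y ∈ U, DifferentiableAt ℝ (fun z ↦ c z a₁ a₂ a₃) y)
    (hcA : ∀ y ∈ U, ∀ v a₁ a₂ a₃, fderiv ℝ (fun z ↦ c z a₁ a₂ a₃) y v =
      -OpSpace.apply F F (OpSpace.apply E _ (A y) v) (c y a₁ a₂ a₃) +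
      (c y (OpSpace.apply F F (OpSpace.apply E _ (A y) v) a₁) a₂ a₃ +
      c y a₁ (OpSpace.apply F F (OpSpace.apply E _ (A y) v) a₂) a₃ +
      c y a₁ a₂ (OpSpace.apply F F (OpSpace.apply E _ (A y) v) a₃)))
    {y : E} (hy : y ∈ U) (h : IsUnit (1 + rayVolterra A y)) (a₁ a₂ a₃ : F) :
    c y (rayTransport A y a₁) (rayTransport A y a₂) (rayTransport A y a₃) =
      rayTransport A y (c 0 a₁ a₂ a₃) := by
  have hmem (t : I) : (t : ℝ) • y ∈ U := hU.smul_mem hy t.2.1 t.2.2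
  let w : C(I, F) := ⟨fun t ↦ c ((t : ℝ) • y) (rayParallel A y a₁ t) (rayParallel A y a₂ t)
    (rayParallel A y a₃ t), by
      refine LinearMap.continuous_trilinear (fun b₁ b₂ b₃ ↦ ?_) (by fun_prop) (by fun_prop)
        (by fun_prop)
      exact continuous_iff_continuousAt.2 fun t ↦ (hc b₁ b₂ b₃ _ (hmem t)).continuousAt.comp
        (f := fun t : I ↦ (t : ℝ) • y) (by fun_prop)⟩
  have key : w = rayParallel A y (w 0) := by
    refine eq_rayParallel_of_hasDerivAt h fun t ht ↦ ?_
    have hty : t • y ∈ U := hmem ⟨t, Ioo_subset_Icc_self ht⟩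
    have hp : projIcc 0 1 zero_le_one t = ⟨t, Ioo_subset_Icc_self ht⟩ :=
      projIcc_of_mem zero_le_one (Ioo_subset_Icc_self ht)
    have h1 : HasDerivAt (fun s : ℝ ↦ s • y) y t := by
      simpa using (hasDerivAt_id t).smul_const y
    have hcd (b₁ b₂ b₃ : F) : HasDerivAt (fun s : ℝ ↦ c (s • y) b₁ b₂ b₃)
        (fderiv ℝ (fun z ↦ c z b₁ b₂ b₃) (t • y) y) t := by
      have h2 := (hc b₁ b₂ b₃ _ hty).hasFDerivAt
      exact h2.comp_hasDerivAt t h1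
    have hd := LinearMap.hasDerivAt_trilinear
      (c' := fun b₁ b₂ b₃ ↦ fderiv ℝ (fun z ↦ c z b₁ b₂ b₃) (t • y) y) hcd
      (hasDerivAt_rayParallel h a₁ ht) (hasDerivAt_rayParallel h a₂ ht)
      (hasDerivAt_rayParallel h a₃ ht)
    have hd' := hd.congr_of_eventuallyEq
      (f₁ := fun s ↦ w (projIcc 0 1 zero_le_one s)) (by
        filter_upwards [Ioo_mem_nhds ht.1 ht.2] with s hs
        simp [w, projIcc_of_mem zero_le_one (Ioo_subset_Icc_self hs)])
    refine hd'.congr_deriv ?_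
    rw [hp]
    simp only [map_neg, LinearMap.neg_apply, hcA _ hty, w, ContinuousMap.coe_mk]
    abel
  have h1 : w 1 = rayParallel A y (w 0) 1 := DFunLike.congr_fun key 1
  have h0 : w 0 = c 0 a₁ a₂ a₃ := by
    simp [w, rayParallel_apply_zero h]
  rw [h0] at h1
  simpa [w] using! h1

end Transport

/-! ### Trivializing a parallel product near a point of a vector space -/

section

variable {E : Type} [NormedAddCommGroup E] [NormedSpace ℝ E] [FiniteDimensional ℝ E]
  {F : Type*} [NormedAddCommGroup F] [NormedSpace ℝ F] [FiniteDimensional ℝ F]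

set_option synthInstance.maxHeartbeats 200000 in
/-- A smooth family of trilinear products which is infinitesimally parallel for a smooth connection
matrix is, near the origin, smoothly isomorphic to its value at the origin. -/
theorem exists_smooth_trivialization_of_parallel {W : Set E} (hW : IsOpen W) (h0 : 0 ∈ W)
    {A : E → E →L[ℝ] F →L[ℝ] F} (hA : ContDiffOn ℝ ∞ A W)
    {c : E → F →ₗ[ℝ] F →ₗ[ℝ] F →ₗ[ℝ] F}
    (hc : ∀ a₁ a₂ a₃, ∀ y ∈ W, DifferentiableAt ℝ (fun z ↦ c z a₁ a₂ a₃) y)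
    (hcA : ∀ y ∈ W, ∀ v a₁ a₂ a₃, fderiv ℝ (fun z ↦ c z a₁ a₂ a₃) y v = -A y v (c y a₁ a₂ a₃) +
      (c y (A y v a₁) a₂ a₃ + c y a₁ (A y v a₂) a₃ + c y a₁ a₂ (A y v a₃))) :
    ∃ U ⊆ W, IsOpen U ∧ 0 ∈ U ∧ ∃ g : E → F →L[ℝ] F, ContDiffOn ℝ ∞ g U ∧
      ∀ y ∈ U, IsUnit (g y) ∧ ∀ a₁ a₂ a₃, c y (g y a₁) (g y a₂) (g y a₃) = g y (c 0 a₁ a₂ a₃) := by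
  have : CompleteSpace F := FiniteDimensional.complete ℝ F
  obtain ⟨ε, hε, hεW⟩ := Metric.isOpen_iff.1 hW 0 h0
  -- A cut-off makes `A` globally smooth with compact support, as ray transport requires. It equals
  -- `1` on the ball of radius `ε / 4`, and its support, of radius `ε / 2`, stays inside `W`.
  let χ : ContDiffBump (0 : E) := ⟨ε / 4, ε / 2, by positivity, by linarith⟩
  let ι : (E →L[ℝ] F →L[ℝ] F) →L[ℝ] OpSpace E (OpSpace F F) :=
    (OpSpace.of E (OpSpace F F)).comp (ContinuousLinearMap.compL ℝ E _ _ (OpSpace.of F F))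
  have hχW : tsupport χ ⊆ W := by
    rw [χ.tsupport_eq]
    exact (Metric.closedBall_subset_ball (by simp only [χ]; linarith)).trans hεW
  have hB : ContDiff ℝ ∞ fun y ↦ χ y • ι (A y) := by
    refine contDiff_iff_contDiffAt.2 fun y ↦ ?_
    by_cases hy : y ∈ tsupport χ
    · have hι : ContDiff ℝ ∞ ι := ContinuousLinearMap.contDiff (𝕜 := ℝ)
        (E := E →L[ℝ] F →L[ℝ] F) (F := OpSpace E (OpSpace F F)) ι
      have h1 : ContDiffAt ℝ ∞ (fun y ↦ ι (A y)) y := hι.contDiffAt.comp y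
        (hA.contDiffAt (hW.mem_nhds (hχW hy)))
      exact χ.contDiff.contDiffAt.smul h1
    · refine (contDiffAt_const (c := 0)).congr_of_eventuallyEq ?_
      filter_upwards [(isClosed_tsupport χ).isOpen_compl.mem_nhds hy] with z hz
      rw [image_eq_zero_of_notMem_tsupport hz, zero_smul]
  let B : C(E, OpSpace E (OpSpace F F)) := ⟨fun y ↦ χ y • ι (A y), hB.continuous⟩
  have hBc : HasCompactSupport B := χ.hasCompactSupport.smul_right
  have hBA {y : E} (hy : y ∈ Metric.ball (0 : E) (ε / 4)) (v : E) (a : F) :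
      OpSpace.apply F F (OpSpace.apply E _ (B y) v) a = A y v a := by
    have h1 : χ y = 1 := χ.one_of_mem_closedBall (Metric.ball_subset_closedBall hy)
    simp [B, h1, ι]
  have hball : Metric.ball (0 : E) (ε / 4) ⊆ W :=
    (Metric.ball_subset_ball (by linarith)).trans hεW
  have hU1 := isOpen_setOf_isUnit_rayVolterra (A := B) hB hBc
  have hg := contDiffOn_rayTransport (A := B) hB hBc
  have hU2 := hg.continuousOn.isOpen_inter_preimage hU1 (Units.isOpen (R := F →L[ℝ] F))
  -- The three conditions on `y`: the cut-off matrix `B` agrees with `A` along the whole ray, the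
  -- transport equation is uniquely solvable, and the transport is invertible. All are open and hold
  -- at `0`.
  refine ⟨Metric.ball 0 (ε / 4) ∩ ({y | IsUnit (1 + rayVolterra B y)} ∩
    rayTransport B ⁻¹' {x | IsUnit x}), fun y hy ↦ hball hy.1, Metric.isOpen_ball.inter hU2,
    ⟨Metric.mem_ball_self (by positivity), ?_, ?_⟩, rayTransport B,
    hg.mono fun y hy ↦ hy.2.1, fun y hy ↦ ⟨hy.2.2, fun a₁ a₂ a₃ ↦ ?_⟩⟩
  · simp [rayVolterra_zero]
  · simp [rayTransport_zero]
  · refine rayTransport_trilinear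
      ((convex_ball (0 : E) (ε / 4)).starConvex (Metric.mem_ball_self (by positivity)))
      (fun b₁ b₂ b₃ z hz ↦ hc b₁ b₂ b₃ z (hball hz)) (fun z hz v a₁ a₂ a₃ ↦ ?_)
      hy.1 hy.2.1 a₁ a₂ a₃
    simp only [hBA hz]
    exact hcA z (hball hz) v a₁ a₂ a₃

end

end RayTransport

/-! ### Product rules on manifolds -/

section MVFDeriv

variable {E : Type*} [NormedAddCommGroup E] [NormedSpace ℝ E]
  {H : Type*} [TopologicalSpace H] {I : ModelWithCorners ℝ E H}
  {M : Type*} [TopologicalSpace M] [ChartedSpace H M]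
  {A : Type*} [NormedAddCommGroup A] [NormedSpace ℝ A]
  {G : Type*} [NormedAddCommGroup G] [NormedSpace ℝ G]

theorem mvfderiv_finsetSum {ι : Type*} (s : Finset ι) {f : ι → M → G} {x : M}
    (hf : ∀ i ∈ s, MDiffAt (f i) x) :
    MDiffAt (fun y ↦ ∑ i ∈ s, f i y) x ∧ d% (fun y ↦ ∑ i ∈ s, f i y) x = ∑ i ∈ s, d% (f i) x := by
  classical
  induction s using Finset.induction_on with
  | empty => simpa using ⟨mdifferentiableAt_const, mvfderiv_const (I := I) (0 : G)⟩
  | insert a s ha ih =>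
    obtain ⟨h1, h2⟩ := ih fun i hi ↦ hf i (Finset.mem_insert_of_mem hi)
    have h3 := hf a (Finset.mem_insert_self a s)
    simp only [Finset.sum_insert ha]
    exact ⟨h3.add h1, by rw [← h2]; exact mvfderiv_add h3 h1⟩

theorem ContinuousLinearMap.mvfderiv_comp (L : A →L[ℝ] G) {f : M → A} {x : M} (hf : MDiffAt f x) :
    MDiffAt (fun y ↦ L (f y)) x ∧ d% (fun y ↦ L (f y)) x = L.comp (d% f x) := by
  have h := L.hasMFDerivAt.comp x hf.hasMFDerivAt
  exact ⟨h.mdifferentiableAt, by ext v; exact congr($h.mfderiv v)⟩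

variable [FiniteDimensional ℝ A]

theorem mvfderiv_linearMap_apply {q : M → A →ₗ[ℝ] G} {f : M → A} {x : M}
    (hq : ∀ a, MDiffAt (fun y ↦ q y a) x) (hf : MDiffAt f x) :
    MDiffAt (fun y ↦ q y (f y)) x ∧ ∀ X, d% (fun y ↦ q y (f y)) x X =
      d% (fun y ↦ q y (f x)) x X + q x (d% f x X) := by
  let b := Module.finBasis ℝ A
  have h (y : M) (a : A) : q y a = ∑ i, b.coord i a • q y (b i) := by
    conv_lhs => rw [← b.sum_repr a, map_sum]
    simp
  have hb (i) := (b.coord i).toContinuousLinearMap.mvfderiv_comp hf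
  have h1 := mvfderiv_finsetSum (I := I) Finset.univ (x := x)
    (f := fun i y ↦ (b.coord i).toContinuousLinearMap (f y) • q y (b i))
    fun i _ ↦ (hb i).1.smul (hq (b i))
  have h2 := mvfderiv_finsetSum (I := I) Finset.univ (x := x)
    (f := fun i y ↦ (b.coord i).toContinuousLinearMap (f x) • q y (b i))
    fun i _ ↦ mdifferentiableAt_const.smul (hq (b i))
  have e1 : (fun y ↦ q y (f y)) =
      fun y ↦ ∑ i, (b.coord i).toContinuousLinearMap (f y) • q y (b i) := funext fun y ↦ h y (f y)
  have e2 : (fun y ↦ q y (f x)) =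
      fun y ↦ ∑ i, (b.coord i).toContinuousLinearMap (f x) • q y (b i) := funext fun y ↦ h y (f x)
  rw [e1, e2]
  refine ⟨h1.1, fun X ↦ ?_⟩
  rw [h1.2, h2.2, h x (d% f x X), sum_apply, sum_apply,
    ← Finset.sum_add_distrib]
  refine Finset.sum_congr rfl fun i _ ↦ ?_
  rw [mvfderiv_fun_smul (hb i).1 (hq (b i)), mvfderiv_fun_smul mdifferentiableAt_const (hq (b i)),
    (hb i).2]
  simp [mvfderiv_const]

theorem mvfderiv_trilinear (R : A →ₗ[ℝ] A →ₗ[ℝ] A →ₗ[ℝ] G) {f₁ f₂ f₃ : M → A} {x : M}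
    (h₁ : MDiffAt f₁ x) (h₂ : MDiffAt f₂ x) (h₃ : MDiffAt f₃ x) (X : TangentSpace I x) :
    d% (fun y ↦ R (f₁ y) (f₂ y) (f₃ y)) x X = R (d% f₁ x X) (f₂ x) (f₃ x) +
      R (f₁ x) (d% f₂ x X) (f₃ x) + R (f₁ x) (f₂ x) (d% f₃ x X) := by
  have k₁ (a₂ a₃ : A) := mvfderiv_linearMap_apply (I := I) (q := fun _ ↦ (R.flip a₂).flip a₃)
    (fun _ ↦ mdifferentiableAt_const) h₁
  have k₂ (a₃ : A) := mvfderiv_linearMap_apply (I := I) (q := fun y ↦ (R (f₁ y)).flip a₃)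
    (fun a₂ ↦ (k₁ a₂ a₃).1) h₂
  have k₃ := mvfderiv_linearMap_apply (I := I) (q := fun y ↦ R (f₁ y) (f₂ y))
    (fun a₃ ↦ (k₂ a₃).1) h₃
  have e₁ := (k₁ (f₂ x) (f₃ x)).2 X
  have e₂ := (k₂ (f₃ x)).2 X
  simp only [LinearMap.flip_apply, mvfderiv_const, zero_apply, zero_add]
    at e₁ e₂
  rw [k₃.2 X, e₂, e₁]

end MVFDeriv

/-! ### The flat connection of a local trivialization -/

section FlatConnection

variable {E : Type*} [NormedAddCommGroup E] [NormedSpace ℝ E]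
  {H : Type*} [TopologicalSpace H] {I : ModelWithCorners ℝ E H}
  {M : Type*} [TopologicalSpace M] [ChartedSpace H M]
  {F : Type*} [NormedAddCommGroup F] [NormedSpace ℝ F]
  {V : M → Type*} [TopologicalSpace (TotalSpace F V)]
  [∀ x, AddCommGroup (V x)] [∀ x, Module ℝ (V x)] [∀ x, TopologicalSpace (V x)]
  [∀ x, IsTopologicalAddGroup (V x)] [∀ x, ContinuousSMul ℝ (V x)]
  [FiberBundle F V] [VectorBundle ℝ F V]

/-- In coordinates, `df ⊗ σ` is the coordinate expression of `df` followed by scalar multiplication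
of the local representative of `σ`, and both depend smoothly on the point. -/
theorem ContMDiffAt.mvfderiv_smulRight_section [IsManifold I ∞ M] [ContMDiffVectorBundle ∞ F V I]
    {f : M → ℝ} {σ : ∀ x, V x} {x₀ : M}
    (hf : CMDiffAt ∞ f x₀) (hσ : CMDiffAt ∞ (T% σ) x₀) :
    ContMDiffAt I (I.prod 𝓘(ℝ, E →L[ℝ] F)) ∞
      (fun x ↦ (⟨x, (d% f x).smulRight (σ x)⟩ :
        TotalSpace (E →L[ℝ] F) fun x ↦ TangentSpace I x →L[ℝ] V x)) x₀ := by
  refine (contMDiffAt_hom_bundle _).2 ⟨contMDiffAt_id, ?_⟩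
  have h1 := hf.mfderiv_const (m := ∞) (by simp)
  have h2 := (contMDiffAt_section x₀).1 hσ
  have h3 : ContMDiffAt I 𝓘(ℝ, E →L[ℝ] F) ∞ (fun x ↦ (ContinuousLinearMap.toSpanSingleton ℝ
      (trivializationAt F V x₀ ⟨x, σ x⟩).2).comp
        (inTangentCoordinates I 𝓘(ℝ, ℝ) id f (mfderiv% f) x₀ x)) x₀ := by
    refine ContMDiffAt.clm_comp ?_ h1
    exact (LinearIsometryEquiv.contDiff
      (ContinuousLinearMap.toSpanSingletonLIE ℝ F)).contMDiff.contMDiffAt.comp x₀ h2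
  refine h3.congr_of_eventuallyEq ?_
  filter_upwards [(trivializationAt F V x₀).open_baseSet.mem_nhds
    (FiberBundle.mem_baseSet_trivializationAt F V x₀)] with x hx
  ext v
  simp [ContinuousLinearMap.inCoordinates, inTangentCoordinates, mvfderiv, hx]
  rfl

variable {A : Type*} [NormedAddCommGroup A] [NormedSpace ℝ A]

variable (I F) in
/-- A smooth identification over the open set `U` of the fibres of the vector bundle `V` with the
vector space `A`. -/
structure IsSmoothFibreEquivOn (U : Set M) (q : ∀ x, V x →ₗ[ℝ] A) (s : ∀ x, A →ₗ[ℝ] V x) :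
    Prop where
  isOpen : IsOpen U
  left_inv {x : M} (hx : x ∈ U) (α : V x) : s x (q x α) = α
  right_inv {x : M} (hx : x ∈ U) (a : A) : q x (s x a) = a
  contMDiffOn_symm (a : A) : CMDiff[U] ∞ (T% fun x ↦ s x a)
  contMDiffAt {σ : ∀ x, V x} {x : M} (hx : x ∈ U) (hσ : CMDiffAt ∞ (T% σ) x) :
    CMDiffAt ∞ (fun y ↦ q y (σ y)) x
  mdifferentiableAt {σ : ∀ x, V x} {x : M} (hx : x ∈ U) (hσ : MDiffAt (T% σ) x) :
    MDiffAt (fun y ↦ q y (σ y)) x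

variable [FiniteDimensional ℝ A] {U : Set M} {q : ∀ x, V x →ₗ[ℝ] A} {s : ∀ x, A →ₗ[ℝ] V x}

variable (I) in
/-- The flat covariant derivative over `U` defined by an identification of the fibres with `A`. -/
noncomputable def flatCov (q : ∀ x, V x →ₗ[ℝ] A) (s : ∀ x, A →ₗ[ℝ] V x) (σ : ∀ x, V x) (x : M) :
    TangentSpace I x →L[ℝ] V x :=
  ∑ i, (d% (fun y ↦ (Module.finBasis ℝ A).coord i (q y (σ y))) x).smulRight
    (s x (Module.finBasis ℝ A i))

-- The basis sum defining `flatCov` consists of terms `df ⊗ σ`, which suits smoothness; the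
-- basis-free form here suits the algebraic identities.
omit [VectorBundle ℝ F V] in
theorem flatCov_apply {σ : ∀ x, V x} {x : M} (hσ : MDiffAt (fun y ↦ q y (σ y)) x) (X :
    TangentSpace I x) :
    flatCov I q s σ x X = s x (d% (fun y ↦ q y (σ y)) x X) := by
  let b := Module.finBasis ℝ A
  have hb (i) := ((b.coord i).toContinuousLinearMap.mvfderiv_comp hσ).2
  conv_rhs => rw [← b.sum_repr (d% (fun y ↦ q y (σ y)) x X), map_sum]
  simp only [flatCov, sum_apply, map_smul]
  refine Finset.sum_congr rfl fun i _ ↦ ?_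
  exact congr($(hb i) X • s x (b i))

omit [VectorBundle ℝ F V] in
theorem IsSmoothFibreEquivOn.isCovariantDerivativeOn (h : IsSmoothFibreEquivOn I F U q s) :
    IsCovariantDerivativeOn F (flatCov I q s) U where
  add {σ σ' x} hσ hσ' hx := by
    have h1 := h.mdifferentiableAt hx hσ
    have h2 := h.mdifferentiableAt hx hσ'
    have e : (fun y ↦ q y ((σ + σ') y)) = (fun y ↦ q y (σ y)) + fun y ↦ q y (σ' y) := by
      ext y; simp
    ext X
    rw [flatCov_apply (by rw [e]; exact h1.add h2), e, mvfderiv_add h1 h2,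
      add_apply, add_apply, flatCov_apply h1,
      flatCov_apply h2, map_add]
  leibniz {σ g x} hσ hg hx := by
    have h1 := h.mdifferentiableAt hx hσ
    have e : (fun y ↦ q y ((g • σ) y)) = g • fun y ↦ q y (σ y) := by
      ext y; simp
    ext X
    rw [flatCov_apply (by rw [e]; exact hg.smul h1), e, mvfderiv_smul hg h1,
      add_apply, add_apply, map_add,
      smul_apply, smul_apply, flatCov_apply h1]
    simp [h.left_inv hx]

theorem IsSmoothFibreEquivOn.contMDiffCovariantDerivativeOn [IsManifold I ∞ M]
    [ContMDiffVectorBundle ∞ F V I] (h : IsSmoothFibreEquivOn I F U q s) :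
    ContMDiffCovariantDerivativeOn F ∞ (flatCov I q s) U where
  contMDiff {σ} hσ := by
    refine ContMDiffOn.sum_section fun i _ x hx ↦ ?_
    refine (ContMDiffAt.mvfderiv_smulRight_section ?_ ?_).contMDiffWithinAt
    · have h1 := h.contMDiffAt hx ((hσ.of_le (by simp)).contMDiffAt (h.isOpen.mem_nhds hx))
      exact ((Module.finBasis ℝ A).coord i).toContinuousLinearMap.contMDiff.contMDiffAt.comp x h1
    · exact (h.contMDiffOn_symm _).contMDiffAt (h.isOpen.mem_nhds hx)

end FlatConnection

/-! ### Gluing connections by a partition of unity -/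

section Gluing

variable {E : Type*} [NormedAddCommGroup E] [NormedSpace ℝ E]
  {H : Type*} [TopologicalSpace H] {I : ModelWithCorners ℝ E H}
  {M : Type*} [TopologicalSpace M] [ChartedSpace H M] [IsManifold I ∞ M]
  {F : Type*} [NormedAddCommGroup F] [NormedSpace ℝ F]
  {V : M → Type*} [TopologicalSpace (TotalSpace F V)]
  [∀ x, AddCommGroup (V x)] [∀ x, Module ℝ (V x)] [∀ x, TopologicalSpace (V x)]
  [∀ x, IsTopologicalAddGroup (V x)] [∀ x, ContinuousSMul ℝ (V x)]
  [FiberBundle F V] [VectorBundle ℝ F V]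
  {ι : Type*} {U : ι → Set M} {ρ : SmoothPartitionOfUnity ι I M}
  {cov : ι → (Π x : M, V x) → (Π x : M, TangentSpace I x →L[ℝ] V x)}

omit [IsManifold I ∞ M] in
theorem SmoothPartitionOfUnity.mem_of_mem_finsupport (hρ : ρ.IsSubordinate U) {i : ι} {x : M}
    (hi : i ∈ ρ.finsupport x) : x ∈ U i :=
  hρ i (subset_tsupport _ ((ρ.mem_finsupport x).1 hi))

omit [IsManifold I ∞ M] [VectorBundle ℝ F V] in
/-- Local covariant derivatives can be glued by a partition of unity. -/
theorem SmoothPartitionOfUnity.isCovariantDerivativeOn_sum (hρ : ρ.IsSubordinate U)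
    (hcov : ∀ i, IsCovariantDerivativeOn F (cov i) (U i)) :
    IsCovariantDerivativeOn F (fun σ x ↦ ∑ i ∈ ρ.finsupport x, ρ i x • cov i σ x) Set.univ where
  add {σ σ' x} hσ hσ' _ := by
    rw [← Finset.sum_add_distrib]
    refine Finset.sum_congr rfl fun i hi ↦ ?_
    rw [(hcov i).add hσ hσ' (mem_of_mem_finsupport hρ hi), smul_add]
  leibniz {σ g x} hσ hg _ := by
    -- Since the weights sum to `1`, the inhomogeneous term of the Leibniz rule is its own weighted
    -- average.
    have h1 : (d% g x).smulRight (σ x) =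
        ∑ i ∈ ρ.finsupport x, ρ i x • (d% g x).smulRight (σ x) := by
      rw [← Finset.sum_smul, ρ.sum_finsupport x (Set.mem_univ x), one_smul]
    rw [h1, Finset.smul_sum, ← Finset.sum_add_distrib]
    refine Finset.sum_congr rfl fun i hi ↦ ?_
    rw [(hcov i).leibniz hσ hg (mem_of_mem_finsupport hρ hi), smul_add, smul_comm]

/-- Each weighted term is smooth on all of `M`, because the support of `ρ i` lies in `U i`, and the
sum is locally finite. -/
theorem SmoothPartitionOfUnity.contMDiffCovariantDerivativeOn_sum [ContMDiffVectorBundle ∞ F V I]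
    (hU : ∀ i, IsOpen (U i)) (hρ : ρ.IsSubordinate U)
    (hcov : ∀ i, ContMDiffCovariantDerivativeOn F ∞ (cov i) (U i)) :
    ContMDiffCovariantDerivativeOn F ∞
      (fun σ x ↦ ∑ i ∈ ρ.finsupport x, ρ i x • cov i σ x) Set.univ where
  contMDiff {σ} hσ := by
    have h1 (i : ι) : ContMDiff I (I.prod 𝓘(ℝ, E →L[ℝ] F)) ∞ fun x ↦
        (⟨x, ρ i x • cov i σ x⟩ : TotalSpace (E →L[ℝ] F) fun x ↦ TangentSpace I x →L[ℝ] V x) :=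
      ContMDiffOn.smul_section_of_tsupport (ρ i).contMDiff.contMDiffOn (hU i) (hρ i)
        ((hcov i).contMDiff (hσ.mono (Set.subset_univ _)))
    have h2 : LocallyFinite fun i ↦ {x : M | ρ i x • cov i σ x ≠ 0} :=
      ρ.locallyFinite.subset fun i x hx ↦ left_ne_zero_of_smul hx
    have h3 := ContMDiff.finsum_section_of_locallyFinite h2 h1
    refine h3.contMDiffOn.congr fun x _ ↦ ?_
    exact congrArg (TotalSpace.mk x) (ρ.sum_finsupport_smul_eq_finsum x fun i _ ↦ cov i σ x)

end Gluing

/-! ### From local triviality to a differential connection -/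

section DifferentialConnection

universe uF

variable {E : Type*} [NormedAddCommGroup E] [NormedSpace ℝ E] [FiniteDimensional ℝ E]
  {H : Type*} [TopologicalSpace H] {I : ModelWithCorners ℝ E H}
  {M : Type*} [TopologicalSpace M] [ChartedSpace H M] [IsManifold I ∞ M] [T2Space M]
  {F : Type uF} [NormedAddCommGroup F] [NormedSpace ℝ F] [FiniteDimensional ℝ F]
  {V : M → Type*} [TopologicalSpace (TotalSpace F V)]
  [∀ x, AddCommGroup (V x)] [∀ x, Module ℝ (V x)] [∀ x, TopologicalSpace (V x)]
  [∀ x, IsTopologicalAddGroup (V x)] [∀ x, ContinuousSMul ℝ (V x)]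
  [FiberBundle F V] [VectorBundle ℝ F V] [ContMDiffVectorBundle ∞ F V I]

/-- Near `x` the map `q` turns the bracket into the constant product `R`, so the identity is the
product rule for `R`, checked after applying the injective map `q x`. -/
theorem flatCov_bracket {A : Type*} [NormedAddCommGroup A] [NormedSpace ℝ A]
    [FiniteDimensional ℝ A] {U : Set M} {q : ∀ x, V x →ₗ[ℝ] A} {s : ∀ x, A →ₗ[ℝ] V x}
    (h : IsSmoothFibreEquivOn I F U q s) (P : ParaAssociativeAlgebroid I F V)
    {R : ParaAssociativeAlgebra ℝ A} (hR : ∀ x ∈ U, ∀ α β γ : V x,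
      q x ((P.fibre x).bracket α β γ) = R.bracket (q x α) (q x β) (q x γ))
    (u v w : Cₛ^∞⟮I; F, V⟯) {x : M} (hx : x ∈ U) (X : TangentSpace I x) :
    flatCov I q s (P.bracket u v w) x X =
      (P.fibre x).bracket (flatCov I q s u x X) (v x) (w x) +
      (P.fibre x).bracket (u x) (flatCov I q s v x X) (w x) +
      (P.fibre x).bracket (u x) (v x) (flatCov I q s w x X) := by
  have hd (u : Cₛ^∞⟮I; F, V⟯) : MDiffAt (fun y ↦ q y (u y)) x :=
    h.mdifferentiableAt hx u.mdifferentiableAt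
  have e : (fun y ↦ q y (P.bracket u v w y)) =ᶠ[𝓝 x]
      fun y ↦ R.bracket (q y (u y)) (q y (v y)) (q y (w y)) := by
    filter_upwards [h.isOpen.mem_nhds hx] with y hy
    rw [← P.fibre_bracket_apply, hR y hy]
  have e' : d% (fun y ↦ q y (P.bracket u v w y)) x X =
      d% (fun y ↦ R.bracket (q y (u y)) (q y (v y)) (q y (w y))) x X :=
    congr($(e.mfderiv_eq (I := I) (I' := 𝓘(ℝ, A))) X)
  have hinj : Function.Injective (q x) := Function.LeftInverse.injective (h.left_inv hx)
  apply hinj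
  rw [map_add, map_add, hR x hx, hR x hx, hR x hx, flatCov_apply (hd _), flatCov_apply (hd _),
    flatCov_apply (hd _), flatCov_apply (hd _), h.right_inv hx, h.right_inv hx, h.right_inv hx,
    h.right_inv hx, e', mvfderiv_trilinear R.bracket (hd u) (hd v) (hd w)]

omit [FiniteDimensional ℝ E] [IsManifold I ∞ M] [T2Space M] [FiniteDimensional ℝ F]
  [∀ x, IsTopologicalAddGroup (V x)] [∀ x, ContinuousSMul ℝ (V x)] [VectorBundle ℝ F V]
  [ContMDiffVectorBundle ∞ F V I] in
theorem IsParaAssociativeAlgebraBundle.exists_isSmoothFibreEquivOn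
    {P : ∀ m, ParaAssociativeAlgebra ℝ (V m)}
    (hP : IsParaAssociativeAlgebraBundle I (F := F) P) (m : M) :
    ∃ (A : Type uF) (_ : NormedAddCommGroup A) (_ : NormedSpace ℝ A) (_ : FiniteDimensional ℝ A)
      (R : ParaAssociativeAlgebra ℝ A) (U : Set M) (q : ∀ x, V x →ₗ[ℝ] A)
      (s : ∀ x, A →ₗ[ℝ] V x), m ∈ U ∧ IsSmoothFibreEquivOn I F U q s ∧ ∀ x ∈ U, ∀ α β γ : V x,
        q x ((P x).bracket α β γ) = R.bracket (q x α) (q x β) (q x γ) := by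
  classical
  obtain ⟨A, _, _, hA, R, ψ, hm, h1, h2, h3⟩ := hP m
  choose φ hφ hR using h3
  have e {σ : ∀ x, V x} {x : M} (hx : x ∈ ψ.baseSet) :
      (fun y ↦ (if h : y ∈ ψ.baseSet then (φ y h : V y →ₗ[ℝ] A) else 0) (σ y)) =ᶠ[𝓝 x]
        fun y ↦ (ψ ⟨y, σ y⟩).2 := by
    filter_upwards [ψ.open_baseSet.mem_nhds hx] with y hy
    rw [dif_pos hy, hφ y hy]
    rfl
  -- The value `0` off the base set is harmless: the base set is open, and every condition concerns
  -- points of it only.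
  refine ⟨A, _, _, hA, R, ψ.baseSet,
    fun x ↦ if h : x ∈ ψ.baseSet then (φ x h : V x →ₗ[ℝ] A) else 0,
    fun x ↦ if h : x ∈ ψ.baseSet then ((φ x h).symm : A →ₗ[ℝ] V x) else 0, hm,
    ⟨ψ.open_baseSet, fun hx α ↦ ?_, fun hx a ↦ ?_, fun a ↦ ?_, fun {σ x} hx hσ ↦ ?_,
      fun {σ x} hx hσ ↦ ?_⟩, fun x hx α β γ ↦ ?_⟩
  · simp [hx]
  · simp [hx]
  · have h3 : CMDiff[ψ.baseSet] ∞ fun x ↦ ψ.toOpenPartialHomeomorph.symm (x, a) :=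
      h2.comp (contMDiffOn_id.prodMk contMDiffOn_const) fun x hx ↦ by simpa [ψ.mem_target] using hx
    refine h3.congr fun x hx ↦ ?_
    have h4 : ψ ⟨x, (φ x hx).symm a⟩ = (x, a) := by
      refine Prod.ext (ψ.coe_fst (by simpa [ψ.mem_source] using hx)) ?_
      rw [hφ x hx, LinearEquiv.apply_symm_apply]
    rw [dif_pos hx, ← h4]
    exact (ψ.left_inv (by simpa [ψ.mem_source] using hx)).symm
  · have h3 := (h1.contMDiffAt (x := (⟨x, σ x⟩ : TotalSpace F V))
      (ψ.open_source.mem_nhds (by simpa [ψ.mem_source] using hx))).comp x hσ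
    exact h3.snd.congr_of_eventuallyEq (e hx)
  · have h3 := ((h1.contMDiffAt (x := (⟨x, σ x⟩ : TotalSpace F V))
      (ψ.open_source.mem_nhds (by simpa [ψ.mem_source] using hx))).mdifferentiableAt
        (by simp)).comp x hσ
    exact h3.snd.congr_of_eventuallyEq (e hx)
  · simp only [dif_pos hx]
    exact hR x hx α β γ

theorem IsParaAssociativeAlgebraBundle.exists_isDifferentialConnection [SigmaCompactSpace M]
    {P : ParaAssociativeAlgebroid I F V}
    (hP : IsParaAssociativeAlgebraBundle I (F := F) fun m ↦ P.fibre m) :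
    ∃ D : CovariantDerivative I F V, IsDifferentialConnection P D := by
  choose A _ _ _ R U q s hm h hR using hP.exists_isSmoothFibreEquivOn
  obtain ⟨ρ, hρ⟩ := SmoothPartitionOfUnity.exists_isSubordinate I isClosed_univ U
    (fun m ↦ (h m).isOpen) fun x _ ↦ Set.mem_iUnion.2 ⟨x, hm x⟩
  let D : CovariantDerivative I F V :=
    ⟨fun σ x ↦ ∑ i ∈ ρ.finsupport x, ρ i x • flatCov I (q i) (s i) σ x,
      SmoothPartitionOfUnity.isCovariantDerivativeOn_sum hρ fun i ↦ (h i).isCovariantDerivativeOn⟩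
  refine ⟨D, ⟨⟨SmoothPartitionOfUnity.contMDiffCovariantDerivativeOn_sum (fun i ↦ (h i).isOpen) hρ
    fun i ↦ (h i).contMDiffCovariantDerivativeOn⟩, fun X u v w ↦ ?_⟩⟩
  ext x
  have hD (σ : ∀ x, V x) (Y : TangentSpace I x) :
      D σ x Y = ∑ i ∈ ρ.finsupport x, ρ i x • flatCov I (q i) (s i) σ x Y := by
    change (∑ i ∈ ρ.finsupport x, ρ i x • flatCov I (q i) (s i) σ x) Y = _
    simp only [sum_apply, smul_apply]
  simp only [ContMDiffSection.coe_add, Pi.add_apply, ← P.fibre_bracket_apply]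
  change D (P.bracket u v w) x (X x) = (P.fibre x).bracket (D u x (X x)) (v x) (w x) +
    (P.fibre x).bracket (u x) (D v x (X x)) (w x) + (P.fibre x).bracket (u x) (v x) (D w x (X x))
  -- Both sides are linear in the connection, so the identity reduces to one flat connection at a
  -- time.
  simp only [hD, map_sum, map_smul, LinearMap.sum_apply, LinearMap.smul_apply,
    ← Finset.sum_add_distrib, ← smul_add]
  exact Finset.sum_congr rfl fun i hi ↦ congrArg _ (flatCov_bracket (h i) P (hR i) u v w
    (SmoothPartitionOfUnity.mem_of_mem_finsupport hρ hi) (X x))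

end DifferentialConnection

/-! ### A connection in a local frame -/

section ConnectionCoefficients

variable {E : Type*} [NormedAddCommGroup E] [NormedSpace ℝ E]
  {H : Type*} [TopologicalSpace H] {I : ModelWithCorners ℝ E H}
  {M : Type*} [TopologicalSpace M] [ChartedSpace H M]
  {F : Type*} [NormedAddCommGroup F] [NormedSpace ℝ F]
  {V : M → Type*} [TopologicalSpace (TotalSpace F V)]
  [∀ x, AddCommGroup (V x)] [∀ x, Module ℝ (V x)] [∀ x, TopologicalSpace (V x)]
  [FiberBundle F V] [VectorBundle ℝ F V]

/-- A frame of a trivialization extends from a neighbourhood of a point to global smooth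
sections. -/
theorem Bundle.Trivialization.exists_section_eq_symmL [FiniteDimensional ℝ E] [IsManifold I ∞ M]
    [T2Space M] [ContMDiffVectorBundle ∞ F V I]
    (t : Trivialization F (TotalSpace.proj : TotalSpace F V → M)) [MemTrivializationAtlas t]
    {m : M} {U : Set M} (hU : IsOpen U) (hm : m ∈ U) (hUt : U ⊆ t.baseSet) :
    ∃ O ⊆ U, IsOpen O ∧ m ∈ O ∧ ∃ e : F → Cₛ^∞⟮I; F, V⟯,
      ∀ a, ∀ x ∈ O, e a x = t.symmL ℝ x a := by
  obtain ⟨f, -, hf⟩ := (SmoothBumpFunction.nhds_basis_tsupport (I := I) m).mem_iff.1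
    (hU.mem_nhds hm)
  have hs (a : F) : CMDiff[U] ∞ (T% fun x ↦ t.symmL ℝ x a) := by
    refine (t.contMDiffOn_section_iff hU hUt).2 ((contMDiffOn_const (c := a)).congr fun x hx ↦ ?_)
    rw [← t.continuousLinearMapAt_apply_of_mem ℝ (hUt hx)]
    exact t.continuousLinearMapAt_symmL (hUt hx) a
  -- Multiplication by the bump function makes the frame global and leaves it unchanged where the
  -- bump function is `1`.
  refine ⟨interior {x | f x = 1}, fun x hx ↦ hf (subset_tsupport _ ?_), isOpen_interior,
    mem_interior_iff_mem_nhds.2 f.eventuallyEq_one, fun a ↦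
    ⟨_, ContMDiffOn.smul_section_of_tsupport f.contMDiff.contMDiffOn hU hf (hs a)⟩,
    fun a x hx ↦ ?_⟩
  · have h : x ∈ {x | f x = 1} := interior_subset hx
    rw [Set.mem_ofPred_eq] at h
    simp [h]
  · have h : x ∈ {x | f x = 1} := interior_subset hx
    rw [Set.mem_ofPred_eq] at h
    change f x • t.symmL ℝ x a = _
    rw [h, one_smul]

variable [∀ x, IsTopologicalAddGroup (V x)] [∀ x, ContinuousSMul ℝ (V x)]

theorem IsCovariantDerivativeOn.sum_smul {cov : (Π x : M, V x) → (Π x : M,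
    TangentSpace I x →L[ℝ] V x)}
    (hcov : IsCovariantDerivativeOn F cov) {ι : Type*} (s : Finset ι) {f : ι → M → ℝ}
    {e : ι → Π x, V x} {x : M} (hf : ∀ i, MDiffAt (f i) x) (he : ∀ i, MDiffAt (T% (e i)) x) :
    MDiffAt (T% (∑ i ∈ s, f i • e i)) x ∧
    cov (∑ i ∈ s, f i • e i) x = ∑ i ∈ s, (f i x • cov (e i) x + (d% (f i) x).smulRight (e i x)) :=
      by
  classical
  induction s using Finset.induction_on with
  | empty => exact ⟨(contMDiff_zeroSection ℝ V).mdifferentiableAt (n := 1) one_ne_zero, hcov.zero⟩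
  | insert i s hi ih =>
    rw [Finset.sum_insert hi, Finset.sum_insert hi, ← ih.2, ← hcov.leibniz (he i) (hf i)]
    have h := (hf i).smul_section (he i)
    exact ⟨mdifferentiableAt_add_section h ih.1, hcov.add h ih.1⟩

/-- This is the formula `∇u = du + A u`. Near `x` the section is a combination of the frame with
coordinate functions as coefficients; locality of `cov` and the Leibniz rule give the two terms. -/
theorem Bundle.Trivialization.continuousLinearMapAt_cov [ContMDiffVectorBundle 1 F V I]
    {ι : Type*} [Fintype ι] (b : Module.Basis ι ℝ F) [FiniteDimensional ℝ F]
    (t : Trivialization F (TotalSpace.proj : TotalSpace F V → M)) [MemTrivializationAtlas t]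
    {cov : (Π x : M, V x) → (Π x : M, TangentSpace I x →L[ℝ] V x)}
    (hcov : IsCovariantDerivativeOn F cov) {O : Set M} (hO : IsOpen O) (hOt : O ⊆ t.baseSet)
    {e : ι → Π x, V x} (he : ∀ i, ∀ x ∈ O, e i x = t.symmL ℝ x (b i))
    (he' : ∀ i, MDiff (T% (e i))) {u : Π x, V x} {x : M} (hx : x ∈ O) (hu : MDiffAt (T% u) x)
    (X : TangentSpace I x) :
    t.continuousLinearMapAt ℝ x (cov u x X) = d% (fun y ↦ (t ⟨y, u y⟩).2) x X +
      ∑ i, b.coord i (t ⟨x, u x⟩).2 • t.continuousLinearMapAt ℝ x (cov (e i) x X) := by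
  have h0 := (t.mdifferentiableAt_section_iff I u (hOt hx)).1 hu
  have h1 (i : ι) := (b.coord i).toContinuousLinearMap.mvfderiv_comp h0
  have h2 := hcov.sum_smul Finset.univ (fun i ↦ (h1 i).1) (fun i ↦ he' i x)
  have h3 : ∀ᶠ y in 𝓝 x, u y =
      (∑ i, (fun y ↦ (b.coord i).toContinuousLinearMap (t ⟨y, u y⟩).2) • e i) y := by
    filter_upwards [hO.mem_nhds hx] with y hy
    simp only [Finset.sum_apply, Pi.smul_apply', he _ y hy]
    simp only [← map_smul, ← map_sum, LinearMap.coe_toContinuousLinearMap',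
      Module.Basis.coord_apply,
      b.sum_repr]
    rw [← t.continuousLinearMapAt_apply_of_mem ℝ (hOt hy), t.symmL_continuousLinearMapAt (hOt hy)]
  rw [hcov.congr_of_eventuallyEq hu h2.1 Filter.univ_mem h3, h2.2]
  simp only [sum_apply, add_apply, smul_apply, map_sum, map_add, map_smul,
    Finset.sum_add_distrib, ContinuousLinearMap.smulRight_apply, (h1 _).2]
  rw [add_comm]
  congr 1
  simp only [he _ x hx, t.continuousLinearMapAt_symmL (hOt hx)]
  exact b.sum_repr _

end ConnectionCoefficients

/-- A translation moves `y₀` to the origin, where the rays start. -/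
theorem exists_smooth_trivialization_of_parallel_at {E : Type} [NormedAddCommGroup E]
    [NormedSpace ℝ E] [FiniteDimensional ℝ E] {F : Type*} [NormedAddCommGroup F] [NormedSpace ℝ F]
    [FiniteDimensional ℝ F] {W : Set E} (hW : IsOpen W) {y₀ : E} (h0 : y₀ ∈ W)
    {A : E → E →L[ℝ] F →L[ℝ] F} (hA : ContDiffOn ℝ ∞ A W) {c : E → F →ₗ[ℝ] F →ₗ[ℝ] F →ₗ[ℝ] F}
    (hc : ∀ a₁ a₂ a₃, ∀ y ∈ W, DifferentiableAt ℝ (fun z ↦ c z a₁ a₂ a₃) y)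
    (hcA : ∀ y ∈ W, ∀ v a₁ a₂ a₃, fderiv ℝ (fun z ↦ c z a₁ a₂ a₃) y v =
      -A y v (c y a₁ a₂ a₃) +
        (c y (A y v a₁) a₂ a₃ + c y a₁ (A y v a₂) a₃ + c y a₁ a₂ (A y v a₃))) :
    ∃ U ⊆ W, IsOpen U ∧ y₀ ∈ U ∧ ∃ g : E → F →L[ℝ] F, ContDiffOn ℝ ∞ g U ∧ ∀ y ∈ U,
      IsUnit (g y) ∧ ∀ a₁ a₂ a₃, c y (g y a₁) (g y a₂) (g y a₃) = g y (c y₀ a₁ a₂ a₃) := by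
  have hadd : ContDiff ℝ ∞ fun y : E ↦ y₀ + y := contDiff_const.add contDiff_id
  have hsub : ContDiff ℝ ∞ fun y : E ↦ y - y₀ := contDiff_id.sub contDiff_const
  obtain ⟨U, hUW, hU, hU0, g, hg, h⟩ := exists_smooth_trivialization_of_parallel
    (hW.preimage hadd.continuous) (by simpa using h0)
    (A := fun y ↦ A (y₀ + y)) (hA.comp hadd.contDiffOn fun _ hy ↦ hy)
    (c := fun y ↦ c (y₀ + y))
    (fun a₁ a₂ a₃ y hy ↦ (hc a₁ a₂ a₃ _ hy).comp y (hadd.differentiable (by simp) y))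
    fun y hy v a₁ a₂ a₃ ↦ by
      rw [fderiv_comp_add_left y₀ (f := fun z ↦ c z a₁ a₂ a₃), hcA _ hy]
  refine ⟨(fun y ↦ y - y₀) ⁻¹' U, fun y hy ↦ by simpa using hUW hy, hU.preimage hsub.continuous,
    by simpa using hU0, fun y ↦ g (y - y₀), hg.comp hsub.contDiffOn fun _ hy ↦ hy, fun y hy ↦ ?_⟩
  simpa using h _ hy

/-- The trilinear product `(a, b, c) ↦ p [s a, s b, s c]`. -/
def LinearMap.conjTrilinear {R A B : Type*} [CommRing R] [AddCommGroup A] [Module R A]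
    [AddCommGroup B] [Module R B] (T : A →ₗ[R] A →ₗ[R] A →ₗ[R] A) (p : A →ₗ[R] B) (s : B →ₗ[R] A) :
    B →ₗ[R] B →ₗ[R] B →ₗ[R] B :=
  LinearMap.mk₂ R (fun a b ↦ p ∘ₗ T (s a) (s b) ∘ₗ s) (fun _ _ _ ↦ by ext; simp)
    (fun _ _ _ ↦ by ext; simp) (fun _ _ _ ↦ by ext; simp) (fun _ _ _ ↦ by ext; simp)

theorem LinearMap.conjTrilinear_apply {R A B : Type*} [CommRing R] [AddCommGroup A] [Module R A]
    [AddCommGroup B] [Module R B] (T : A →ₗ[R] A →ₗ[R] A →ₗ[R] A) (p : A →ₗ[R] B)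
    (s : B →ₗ[R] A) (a b c : B) : T.conjTrilinear p s a b c = p (T (s a) (s b) (s c)) := rfl

/-! ### Connection coefficients in a chart -/

section LocalCoefficients

variable {E : Type*} [NormedAddCommGroup E] [NormedSpace ℝ E]
  {H : Type*} [TopologicalSpace H] {I : ModelWithCorners ℝ E H}
  {M : Type*} [TopologicalSpace M] [ChartedSpace H M] [IsManifold I ∞ M]
  {F : Type*} [NormedAddCommGroup F] [NormedSpace ℝ F]
  {V : M → Type*} [TopologicalSpace (TotalSpace F V)]
  [∀ x, AddCommGroup (V x)] [∀ x, Module ℝ (V x)] [∀ x, TopologicalSpace (V x)]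
  [∀ x, IsTopologicalAddGroup (V x)] [∀ x, ContinuousSMul ℝ (V x)]
  [FiberBundle F V] [VectorBundle ℝ F V]

/-- The chain rule, as the tangent trivialization at `m` is inverted by the derivative of the
inverse chart. Without boundary, derivatives within the range of the model are full derivatives. -/
theorem mvfderiv_comp_extChartAt_symm [I.Boundaryless] (m : M) {f : M → F} {y : E}
    (hy : y ∈ (extChartAt I m).target) (hf : MDiffAt f ((extChartAt I m).symm y)) :
    DifferentiableAt ℝ (fun z ↦ f ((extChartAt I m).symm z)) y ∧
    ∀ v, fderiv ℝ (fun z ↦ f ((extChartAt I m).symm z)) y v =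
      d% f ((extChartAt I m).symm y) ((trivializationAt E (TangentSpace I) m).symmL ℝ
        ((extChartAt I m).symm y) v) := by
  have h1 : MDiffAt (extChartAt I m).symm y := by
    have := mdifferentiableWithinAt_extChartAt_symm (I := I) hy
    rwa [I.range_eq_univ, mdifferentiableWithinAt_univ] at this
  have h2 := hf.hasMFDerivAt.comp y h1.hasMFDerivAt
  have h3 : HasFDerivAt (𝕜 := ℝ) (E := E) (F := F) (fun z ↦ f ((extChartAt I m).symm z)) _ y :=
    hasMFDerivAt_iff_hasFDerivAt.1 h2
  refine ⟨h3.differentiableAt, fun v ↦ ?_⟩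
  have hx : (extChartAt I m).symm y ∈ (chartAt H m).source := by
    rw [← extChartAt_source I m]
    exact (extChartAt I m).map_target hy
  rw [TangentBundle.symmL_trivializationAt hx, (extChartAt I m).right_inv hy, I.range_eq_univ,
    mfderivWithin_univ]
  exact congr($h3.fderiv v)

variable (I) in
/-- The connection coefficients of `cov` in the chart and the trivialization at `m`, for a frame
`e` that extends the basis `b`. -/
noncomputable def connectionCoeff {ι : Type*} [Fintype ι] [FiniteDimensional ℝ F]
    (b : Module.Basis ι ℝ F)
    (cov : (Π x : M, V x) → (Π x : M, TangentSpace I x →L[ℝ] V x)) (e : ι → Π x, V x) (m : M)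
    (y : E) : E →L[ℝ] F →L[ℝ] F :=
  ∑ i, (ContinuousLinearMap.smulRightL ℝ F F (b.coord i).toContinuousLinearMap).comp
    (ContinuousLinearMap.inCoordinates E (TangentSpace I) F V m ((extChartAt I m).symm y) m
      ((extChartAt I m).symm y) (cov (e i) ((extChartAt I m).symm y)))

omit [∀ x, IsTopologicalAddGroup (V x)] [∀ x, ContinuousSMul ℝ (V x)] in
theorem connectionCoeff_apply {ι : Type*} [Fintype ι] [FiniteDimensional ℝ F]
    (b : Module.Basis ι ℝ F)
    (cov : (Π x : M, V x) → (Π x : M, TangentSpace I x →L[ℝ] V x)) (e : ι → Π x, V x) (m : M)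
    (y v : E) (a : F) : connectionCoeff I b cov e m y v a =
      ∑ i, b.coord i a • (trivializationAt F V m).continuousLinearMapAt ℝ ((extChartAt I m).symm y)
        (cov (e i) ((extChartAt I m).symm y) ((trivializationAt E (TangentSpace I) m).symmL ℝ
          ((extChartAt I m).symm y) v)) := by
  simp only [connectionCoeff, sum_apply]
  rfl

theorem contDiffOn_connectionCoeff [I.Boundaryless] [ContMDiffVectorBundle ∞ F V I]
    {ι : Type*} [Fintype ι] [FiniteDimensional ℝ F] (b : Module.Basis ι ℝ F)
    {cov : (Π x : M, V x) → (Π x : M, TangentSpace I x →L[ℝ] V x)}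
    (hcov : ContMDiffCovariantDerivativeOn F ∞ cov Set.univ) {e : ι → Cₛ^∞⟮I; F, V⟯} {m : M}
    {O : Set M} (hO : IsOpen O) (hOt : O ⊆ (trivializationAt F V m).baseSet)
    (hOm : O ⊆ (chartAt H m).source) :
    ContDiffOn ℝ ∞ (connectionCoeff I b cov (fun i ↦ e i) m)
      ((extChartAt I m).target ∩ (extChartAt I m).symm ⁻¹' O) := by
  have h1 (i : ι) : ContMDiffOn I 𝓘(ℝ, E →L[ℝ] F) ∞ (fun x ↦
      ContinuousLinearMap.inCoordinates E (TangentSpace I) F V m x m x (cov (e i) x)) O := by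
    have hu : CMDiff[Set.univ] ((∞ : ℕ∞ω) + 1) (T% fun x ↦ e i x) := by
      simpa using! (e i).contMDiff.contMDiffOn
    have h := (hcov.contMDiff hu).mono (Set.subset_univ O)
    exact ((trivializationAt (E →L[ℝ] F) (fun x ↦ TangentSpace I x →L[ℝ] V x)
      m).contMDiffOn_section_iff hO fun x hx ↦ ⟨hOm hx, hOt hx⟩).1 h
  have h2 (i : ι) := (h1 i).comp ((contMDiffOn_extChartAt_symm (I := I) (n := ∞) m).mono
    Set.inter_subset_left) fun y (hy : y ∈ (extChartAt I m).target ∩ (extChartAt I m).symm ⁻¹' O) ↦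
      hy.2
  refine ContDiffOn.sum fun i _ ↦ ?_
  exact contDiffOn_const.clm_comp (contMDiffOn_iff_contDiffOn.1 (h2 i))

end LocalCoefficients

/-! ### The product is parallel -/

section Parallel

variable {E : Type*} [NormedAddCommGroup E] [NormedSpace ℝ E] [FiniteDimensional ℝ E]
  {H : Type*} [TopologicalSpace H] {I : ModelWithCorners ℝ E H}
  {M : Type*} [TopologicalSpace M] [ChartedSpace H M] [IsManifold I ∞ M] [T2Space M]
  {F : Type*} [NormedAddCommGroup F] [NormedSpace ℝ F] [FiniteDimensional ℝ F]
  {V : M → Type*} [TopologicalSpace (TotalSpace F V)]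
  [∀ x, AddCommGroup (V x)] [∀ x, Module ℝ (V x)] [∀ x, TopologicalSpace (V x)]
  [∀ x, IsTopologicalAddGroup (V x)] [∀ x, ContinuousSMul ℝ (V x)]
  [FiberBundle F V] [VectorBundle ℝ F V] [ContMDiffVectorBundle ∞ F V I]

/-- Every tangent vector is the value of a global smooth vector field, which makes the Leibniz
identity pointwise. -/
theorem IsDifferentialConnection.leibniz_apply {P : ParaAssociativeAlgebroid I F V}
    {D : CovariantDerivative I F V} (hD : IsDifferentialConnection P D) (u v w : Cₛ^∞⟮I; F, V⟯)
    (x : M) (X : TangentSpace I x) :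
    D (P.bracket u v w) x X = (P.fibre x).bracket (D u x X) (v x) (w x) +
      (P.fibre x).bracket (u x) (D v x X) (w x) + (P.fibre x).bracket (u x) (v x) (D w x X) := by
  obtain ⟨Y, rfl⟩ := exists_smoothSection_eq (I := I) (F := E) (V := TangentSpace I) x X
  have : D.ContMDiffCovariantDerivative ∞ := hD.smooth
  have h := congrArg (fun s : Cₛ^∞⟮I; F, V⟯ ↦ s x) (hD.leibniz Y u v w)
  simp only [ContMDiffSection.coe_add, Pi.add_apply, ← P.fibre_bracket_apply] at h
  exact h

/-- The fibre product in the trivialization at `m`. -/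
noncomputable def ParaAssociativeAlgebroid.localBracket (P : ParaAssociativeAlgebroid I F V)
    (m x : M) : F →ₗ[ℝ] F →ₗ[ℝ] F →ₗ[ℝ] F :=
  (P.fibre x).bracket.conjTrilinear ((trivializationAt F V m).continuousLinearMapAt ℝ x)
    ((trivializationAt F V m).symmL ℝ x)

/-- The Leibniz identity is applied to the sections `e a₁`, `e a₂`, `e a₃`. Their bracket has local
representative `c a₁ a₂ a₃`, so its covariant derivative is `dc + A c`; each `e a` has constant
representative, so its own is `A a`. Solving for `dc` gives the formula. -/
theorem IsDifferentialConnection.fderiv_localBracket [I.Boundaryless]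
    {P : ParaAssociativeAlgebroid I F V} {D : CovariantDerivative I F V}
    (hD : IsDifferentialConnection P D) {m : M} {O : Set M} (hO : IsOpen O)
    (hOt : O ⊆ (trivializationAt F V m).baseSet) {e : F → Cₛ^∞⟮I; F, V⟯}
    (he : ∀ a, ∀ x ∈ O, e a x = (trivializationAt F V m).symmL ℝ x a) {y : E}
    (hy : y ∈ (extChartAt I m).target ∩ (extChartAt I m).symm ⁻¹' O) (a₁ a₂ a₃ : F) :
    DifferentiableAt ℝ (fun z ↦ P.localBracket m ((extChartAt I m).symm z) a₁ a₂ a₃) y ∧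
    ∀ v, fderiv ℝ (fun z ↦ P.localBracket m ((extChartAt I m).symm z) a₁ a₂ a₃) y v =
      let A := connectionCoeff I (Module.finBasis ℝ F) D (fun i ↦ e (Module.finBasis ℝ F i)) m y;
      let c := P.localBracket m ((extChartAt I m).symm y);
      -A v (c a₁ a₂ a₃) + (c (A v a₁) a₂ a₃ + c a₁ (A v a₂) a₃ + c a₁ a₂ (A v a₃)) := by
  have : ContMDiffVectorBundle 1 F V I := ContMDiffVectorBundle.of_le (n := ∞) (by simp)
  set t := trivializationAt F V m with ht
  obtain ⟨hyt, hyO⟩ := hy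
  have hyO : (extChartAt I m).symm y ∈ O := hyO
  have hc (x : M) (hx : x ∈ O) : P.localBracket m x a₁ a₂ a₃ =
      (t ⟨x, P.bracket (e a₁) (e a₂) (e a₃) x⟩).2 := by
    rw [← t.continuousLinearMapAt_apply_of_mem ℝ (hOt hx), ← P.fibre_bracket_apply, he _ x hx,
      he _ x hx, he _ x hx]
    rfl
  have hd (u : Cₛ^∞⟮I; F, V⟯) : MDiffAt (fun x ↦ (t ⟨x, u x⟩).2) ((extChartAt I m).symm y) :=
    (t.mdifferentiableAt_section_iff I u (hOt hyO)).1 u.mdifferentiableAt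
  have hev : ∀ᶠ z in 𝓝 y, (extChartAt I m).symm z ∈ O :=
    (continuousAt_extChartAt_symm'' hyt).preimage_mem_nhds (hO.mem_nhds hyO)
  have hcev : (fun z ↦ P.localBracket m ((extChartAt I m).symm z) a₁ a₂ a₃) =ᶠ[𝓝 y]
      fun z ↦ (fun x ↦ (t ⟨x, P.bracket (e a₁) (e a₂) (e a₃) x⟩).2) ((extChartAt I m).symm z) :=
    hev.mono fun z hz ↦ hc _ hz
  obtain ⟨h1, h2⟩ := mvfderiv_comp_extChartAt_symm m hyt (hd (P.bracket (e a₁) (e a₂) (e a₃)))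
  refine ⟨h1.congr_of_eventuallyEq hcev, fun v ↦ ?_⟩
  let A := connectionCoeff I (Module.finBasis ℝ F) D (fun i ↦ e (Module.finBasis ℝ F i)) m y
  let c := P.localBracket m ((extChartAt I m).symm y)
  change _ = -A v (c a₁ a₂ a₃) + (c (A v a₁) a₂ a₃ + c a₁ (A v a₂) a₃ + c a₁ a₂ (A v a₃))
  rw [hcev.fderiv_eq, h2]
  have hcov (u : Cₛ^∞⟮I; F, V⟯) (X) := t.continuousLinearMapAt_cov (Module.finBasis ℝ F)
    D.isCovariantDerivativeOn hO hOt (e := fun i ↦ e (Module.finBasis ℝ F i)) (fun i ↦ he _)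
    (fun i ↦ (e (Module.finBasis ℝ F i)).mdifferentiable) hyO (u := u) u.mdifferentiableAt X
  set X := (trivializationAt E (TangentSpace I) m).symmL ℝ ((extChartAt I m).symm y) v with hX
  have hA (a : F) : A v a = t.continuousLinearMapAt ℝ ((extChartAt I m).symm y)
      (D (e a) ((extChartAt I m).symm y) X) := by
    have hea : (fun x ↦ (t ⟨x, e a x⟩).2) =ᶠ[𝓝 ((extChartAt I m).symm y)] fun _ ↦ a := by
      filter_upwards [hO.mem_nhds hyO] with x hx
      rw [← t.continuousLinearMapAt_apply_of_mem ℝ (hOt hx), he _ x hx,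
        t.continuousLinearMapAt_symmL (hOt hx)]
    have h3 : d% (fun x ↦ (t ⟨x, e a x⟩).2) ((extChartAt I m).symm y) X = 0 := by
      have h4 := congr($(hea.mfderiv_eq (I := I) (I' := 𝓘(ℝ, F))) X)
      rw [mfderiv_const] at h4
      exact h4
    rw [hcov, h3, zero_add, hea.eq_of_nhds]
    exact connectionCoeff_apply ..
  have h4 := hcov (P.bracket (e a₁) (e a₂) (e a₃)) X
  have h5 := connectionCoeff_apply (I := I) (Module.finBasis ℝ F) D
    (fun i ↦ e (Module.finBasis ℝ F i)) m y v (c a₁ a₂ a₃)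
  rw [← hc _ hyO] at h4
  rw [← h5, hD.leibniz_apply, he _ _ hyO, he _ _ hyO, he _ _ hyO] at h4
  have h6 (a : F) : D (e a) ((extChartAt I m).symm y) X =
      t.symmL ℝ ((extChartAt I m).symm y) (A v a) := by
    rw [hA, t.symmL_continuousLinearMapAt (hOt hyO)]
  rw [h6, h6, h6, map_add, map_add] at h4
  exact (neg_add_eq_of_eq_add (h4.trans (add_comm _ _))).symm

end Parallel

/-! ### Ray transport on the manifold -/

section LocalTriviality

variable {E : Type} [NormedAddCommGroup E] [NormedSpace ℝ E] [FiniteDimensional ℝ E]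
  {H : Type*} [TopologicalSpace H] {I : ModelWithCorners ℝ E H} [I.Boundaryless]
  {M : Type*} [TopologicalSpace M] [ChartedSpace H M] [IsManifold I ∞ M] [T2Space M]
  {F : Type*} [NormedAddCommGroup F] [NormedSpace ℝ F] [FiniteDimensional ℝ F]
  {V : M → Type*} [TopologicalSpace (TotalSpace F V)]
  [∀ x, AddCommGroup (V x)] [∀ x, Module ℝ (V x)] [∀ x, TopologicalSpace (V x)]
  [∀ x, IsTopologicalAddGroup (V x)] [∀ x, ContinuousSMul ℝ (V x)]
  [FiberBundle F V] [VectorBundle ℝ F V] [ContMDiffVectorBundle ∞ F V I]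

theorem IsDifferentialConnection.exists_localBracket_eq {P : ParaAssociativeAlgebroid I F V}
    {D : CovariantDerivative I F V} (hD : IsDifferentialConnection P D) (m : M) :
    ∃ U ⊆ (trivializationAt F V m).baseSet, IsOpen U ∧ m ∈ U ∧ ∃ G : M → F →L[ℝ] F,
      ContMDiffOn I 𝓘(ℝ, F →L[ℝ] F) ∞ G U ∧ ∀ x ∈ U, IsUnit (G x) ∧ ∀ a₁ a₂ a₃,
        P.localBracket m x (G x a₁) (G x a₂) (G x a₃) = G x (P.localBracket m m a₁ a₂ a₃) := by
  set t := trivializationAt F V m with ht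
  obtain ⟨O, hOt, hO, hmO, e, he⟩ := t.exists_section_eq_symmL (I := I)
    (t.open_baseSet.inter (chartAt H m).open_source)
    ⟨FiberBundle.mem_baseSet_trivializationAt F V m, mem_chart_source H m⟩ Set.inter_subset_left
  have hOt' : O ⊆ t.baseSet := hOt.trans Set.inter_subset_left
  have hOm : O ⊆ (chartAt H m).source := hOt.trans Set.inter_subset_right
  have hW : IsOpen ((extChartAt I m).target ∩ (extChartAt I m).symm ⁻¹' O) :=
    (continuousOn_extChartAt_symm m).isOpen_inter_preimage (isOpen_extChartAt_target m) hO
  have hcov : ContMDiffCovariantDerivativeOn F ∞ D Set.univ := hD.smooth.contMDiff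
  obtain ⟨U, hUW, hU, hmU, g, hg, hgU⟩ := exists_smooth_trivialization_of_parallel_at hW
    (y₀ := extChartAt I m m) ⟨mem_extChartAt_target m, by simpa using hmO⟩
    (contDiffOn_connectionCoeff (Module.finBasis ℝ F) hcov
      (e := fun i ↦ e (Module.finBasis ℝ F i)) hO hOt' hOm)
    (c := fun y ↦ P.localBracket m ((extChartAt I m).symm y))
    (fun a₁ a₂ a₃ y hy ↦ (hD.fderiv_localBracket hO hOt' he hy a₁ a₂ a₃).1)
    (fun y hy v a₁ a₂ a₃ ↦ (hD.fderiv_localBracket hO hOt' he hy a₁ a₂ a₃).2 v)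
  have hinv (x : M) (hx : x ∈ (chartAt H m).source) :
      (extChartAt I m).symm (extChartAt I m x) = x :=
    (extChartAt I m).left_inv (by rwa [extChartAt_source])
  refine ⟨(chartAt H m).source ∩ extChartAt I m ⁻¹' U, fun x hx ↦ ?_, ?_, ⟨mem_chart_source H m,
    hmU⟩,
    fun x ↦ g (extChartAt I m x), ?_, fun x hx ↦ ?_⟩
  · have h := (hUW hx.2).2
    rw [Set.mem_preimage, hinv x hx.1] at h
    exact hOt' h
  · rw [← extChartAt_source I m]
    exact (continuousOn_extChartAt m).isOpen_inter_preimage (isOpen_extChartAt_source m) hU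
  · exact (contMDiffOn_iff_contDiffOn.2 hg).comp ((contMDiffOn_extChartAt (I := I) (x := m)).mono
      Set.inter_subset_left) fun x hx ↦ hx.2
  · have h := hgU _ hx.2
    simp only [extChartAt_to_inv] at h
    rwa [hinv x hx.1] at h

end LocalTriviality

/-! ### Changing a trivialization by a smooth family of linear maps -/

section FiberwiseLinearChange

variable {E : Type*} [NormedAddCommGroup E] [NormedSpace ℝ E]
  {H : Type*} [TopologicalSpace H] {I : ModelWithCorners ℝ E H}
  {M : Type*} [TopologicalSpace M] [ChartedSpace H M]
  {F : Type*} [NormedAddCommGroup F] [NormedSpace ℝ F]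

/-- Transport `G x` leads from the fibre at `m` to the fibre at `x`, whereas a trivialization goes
the other way, hence `φ x` is the inverse of `G x`. It is smooth because inversion of operators is;
outside `U` the identity serves as a default. -/
theorem ContMDiffOn.exists_continuousLinearEquiv [CompleteSpace F] {U : Set M}
    {G : M → F →L[ℝ] F} (hU : IsOpen U) (hG : ContMDiffOn I 𝓘(ℝ, F →L[ℝ] F) ∞ G U)
    (hunit : ∀ x ∈ U, IsUnit (G x)) :
    ∃ φ : M → F ≃L[ℝ] F, (∀ x ∈ U, ((φ x).symm : F →L[ℝ] F) = G x) ∧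
      ContMDiffOn I 𝓘(ℝ, F →L[ℝ] F) ∞ (fun x ↦ ((φ x).symm : F →L[ℝ] F)) U ∧
      ContMDiffOn I 𝓘(ℝ, F →L[ℝ] F) ∞ (fun x ↦ (φ x : F →L[ℝ] F)) U := by
  classical
  choose u hu using hunit
  let φ (x : M) : F ≃L[ℝ] F :=
    if hx : x ∈ U then ContinuousLinearEquiv.ofUnit (u x hx)⁻¹ else .refl ℝ F
  have h1 (x) (hx : x ∈ U) : ((φ x).symm : F →L[ℝ] F) = G x := by
    ext a
    simp only [φ, dif_pos hx, ← hu x hx]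
    rfl
  have h2 (x) (hx : x ∈ U) : (φ x : F →L[ℝ] F) = Ring.inverse (G x) := by
    ext a
    simp only [φ, dif_pos hx, ← hu x hx, Ring.inverse_unit]
    rfl
  refine ⟨φ, h1, hG.congr h1, fun x hx ↦ ?_⟩
  have h3 : ContDiffAt ℝ ∞ Ring.inverse (G x) := hu x hx ▸ contDiffAt_ringInverse ℝ (u x hx)
  exact ((h3.contMDiffAt.comp x (hG.contMDiffAt (hU.mem_nhds hx))).contMDiffWithinAt).congr h2
    (h2 x hx)

variable {V : M → Type*} [TopologicalSpace (TotalSpace F V)]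
  [∀ x, AddCommGroup (V x)] [∀ x, Module ℝ (V x)] [∀ x, TopologicalSpace (V x)]
  [FiberBundle F V] [VectorBundle ℝ F V] [ContMDiffVectorBundle ∞ F V I]

theorem Bundle.Trivialization.exists_smooth_fiberwiseLinear
    (t : Trivialization F (TotalSpace.proj : TotalSpace F V → M)) [MemTrivializationAtlas t]
    {U : Set M} (hU : IsOpen U) (hUt : U ⊆ t.baseSet) {φ : M → F ≃L[ℝ] F}
    (hφ : ContMDiffOn I 𝓘(ℝ, F →L[ℝ] F) ∞ (fun x ↦ (φ x : F →L[ℝ] F)) U)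
    (hφ' : ContMDiffOn I 𝓘(ℝ, F →L[ℝ] F) ∞ (fun x ↦ ((φ x).symm : F →L[ℝ] F)) U) :
    ∃ ψ : Trivialization F (TotalSpace.proj : TotalSpace F V → M), ψ.baseSet = U ∧
      ContMDiffOn (I.prod 𝓘(ℝ, F)) (I.prod 𝓘(ℝ, F)) ∞ ψ ψ.source ∧
      ContMDiffOn (I.prod 𝓘(ℝ, F)) (I.prod 𝓘(ℝ, F)) ∞ ψ.toOpenPartialHomeomorph.symm ψ.target ∧
      ∀ x ∈ U, ∀ α : V x, (ψ ⟨x, α⟩).2 = φ x (t ⟨x, α⟩).2 := by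
  let k := FiberwiseLinear.openPartialHomeomorph φ hU hφ.continuousOn hφ'.continuousOn
  have hsmooth {χ : M → F ≃L[ℝ] F}
      (hχ : ContMDiffOn I 𝓘(ℝ, F →L[ℝ] F) ∞ (fun x ↦ (χ x : F →L[ℝ] F)) U) :
      ContMDiffOn (I.prod 𝓘(ℝ, F)) (I.prod 𝓘(ℝ, F)) ∞ (fun p : M × F ↦ (p.1, χ p.1 p.2))
        (U ×ˢ Set.univ) :=
    contMDiffOn_fst.prodMk ((hχ.comp contMDiffOn_fst fun p hp ↦ hp.1).clm_apply contMDiffOn_snd)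
  have hsrc (p : TotalSpace F V) : p ∈ (t.toOpenPartialHomeomorph.trans k).source ↔ p.1 ∈ U := by
    rw [OpenPartialHomeomorph.trans_source]
    constructor
    · rintro ⟨h1, h2⟩
      have h3 : (t p).1 ∈ U := h2.1
      rwa [t.coe_fst h1] at h3
    · intro h
      have h1 : p ∈ t.source := t.mem_source.2 (hUt h)
      refine ⟨h1, ?_, Set.mem_univ _⟩
      change (t p).1 ∈ U
      rwa [t.coe_fst h1]
  let ψ : Trivialization F (TotalSpace.proj : TotalSpace F V → M) :=
    { t.toOpenPartialHomeomorph.trans k with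
      baseSet := U
      open_baseSet := hU
      source_eq := Set.ext hsrc
      target_eq := by
        refine Set.ext fun p ↦ ⟨fun hp ↦ hp.1, fun hp ↦ ⟨hp, ?_⟩⟩
        exact t.mem_target.2 (hUt hp.1)
      proj_toFun := fun p hp ↦ t.coe_fst ((hsrc p).1 hp |> fun h ↦ t.mem_source.2 (hUt h)) }
  refine ⟨ψ, rfl, ?_, ?_, fun x hx α ↦ ?_⟩
  · exact (hsmooth hφ).comp ((t.contMDiffOn (IB := I) (n := ∞)).mono fun p hp ↦ hp.1)
      fun p hp ↦ hp.2
  · exact (t.contMDiffOn_symm (IB := I) (n := ∞)).comp ((hsmooth (χ := fun x ↦ (φ x).symm) hφ').mono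
      fun p hp ↦ hp.1) fun p hp ↦ hp.2
  · change φ (t ⟨x, α⟩).1 (t ⟨x, α⟩).2 = _
    rw [t.coe_fst (t.mem_source.2 (hUt hx))]

end FiberwiseLinearChange

/-- Transport of a para-associative algebra structure along a linear isomorphism. -/
def ParaAssociativeAlgebra.transport {R A B : Type*} [CommRing R] [AddCommGroup A] [Module R A]
    [AddCommGroup B] [Module R B] (P : ParaAssociativeAlgebra R A) (φ : A ≃ₗ[R] B) :
    ParaAssociativeAlgebra R B where
  bracket := P.bracket.conjTrilinear φ φ.symm
  para_left _ _ _ _ _ := by simp [LinearMap.conjTrilinear_apply, P.para_left]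
  para_right _ _ _ _ _ := by simp [LinearMap.conjTrilinear_apply, P.para_right]

theorem ParaAssociativeAlgebra.isIso_transport {R A B : Type*} [CommRing R] [AddCommGroup A]
    [Module R A] [AddCommGroup B] [Module R B] (P : ParaAssociativeAlgebra R A) (φ : A ≃ₗ[R] B) :
    P.IsIso (P.transport φ) φ := fun _ _ _ ↦ by
  simp [ParaAssociativeAlgebra.transport, LinearMap.conjTrilinear_apply]

/-! ### From a differential connection to local triviality -/

section LocalTriviality

variable {E : Type} [NormedAddCommGroup E] [NormedSpace ℝ E] [FiniteDimensional ℝ E]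
  {H : Type*} [TopologicalSpace H] {I : ModelWithCorners ℝ E H} [I.Boundaryless]
  {M : Type*} [TopologicalSpace M] [ChartedSpace H M] [IsManifold I ∞ M] [T2Space M]
  {F : Type*} [NormedAddCommGroup F] [NormedSpace ℝ F] [FiniteDimensional ℝ F]
  {V : M → Type*} [TopologicalSpace (TotalSpace F V)]
  [∀ x, AddCommGroup (V x)] [∀ x, Module ℝ (V x)] [∀ x, TopologicalSpace (V x)]
  [∀ x, IsTopologicalAddGroup (V x)] [∀ x, ContinuousSMul ℝ (V x)]
  [FiberBundle F V] [VectorBundle ℝ F V] [ContMDiffVectorBundle ∞ F V I]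

theorem IsDifferentialConnection.isParaAssociativeAlgebraBundle
    {P : ParaAssociativeAlgebroid I F V} {D : CovariantDerivative I F V}
    (hD : IsDifferentialConnection P D) :
    IsParaAssociativeAlgebraBundle I (F := F) fun m ↦ P.fibre m := by
  have : CompleteSpace F := FiniteDimensional.complete ℝ F
  intro m
  obtain ⟨U, hUt, hU, hm, G, hG, h⟩ := hD.exists_localBracket_eq m
  obtain ⟨φ, hφG, hφ', hφ⟩ := hG.exists_continuousLinearEquiv hU fun x hx ↦ (h x hx).1
  set t := trivializationAt F V m with ht
  obtain ⟨ψ, hψU, h1, h2, hψ⟩ := t.exists_smooth_fiberwiseLinear hU hUt hφ hφ'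
  have htm : m ∈ t.baseSet := FiberBundle.mem_baseSet_trivializationAt F V m
  refine ⟨F, _, _, inferInstance,
    (P.fibre m).transport (t.continuousLinearEquivAt ℝ m htm).toLinearEquiv, ψ, hψU ▸ hm, h1, h2,
    fun x hx ↦ ?_⟩
  rw [hψU] at hx
  have hxt := hUt hx
  refine ⟨(t.continuousLinearEquivAt ℝ x hxt).toLinearEquiv.trans (φ x).toLinearEquiv,
    fun α ↦ hψ x hx α, fun α β γ ↦ ?_⟩
  have hloc (n : M) (hn : n ∈ t.baseSet) (a b c : F) : P.localBracket m n a b c =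
      ((P.fibre n).transport (t.continuousLinearEquivAt ℝ n hn).toLinearEquiv).bracket a b c := by
    simp [ParaAssociativeAlgebroid.localBracket, ParaAssociativeAlgebra.transport,
      LinearMap.conjTrilinear_apply, ← ht, hn]
  have hGφ (a : F) : G x (φ x a) = a := by
    rw [← hφG x hx]
    exact (φ x).symm_apply_apply a
  -- With arguments `φ x` of the coordinates of `α`, `β`, `γ`, the maps `G x` inside the bracket
  -- cancel. Applying `φ x` then removes the outer `G x`, and `φ x` after `t` is an algebra
  -- isomorphism onto the fibre at `m` read in `t`.
  have key := (h x hx).2 (φ x (t ⟨x, α⟩).2) (φ x (t ⟨x, β⟩).2) (φ x (t ⟨x, γ⟩).2)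
  rw [hGφ, hGφ, hGφ, hloc x hxt, hloc m htm] at key
  have hφG' (a : F) : φ x (G x a) = a := by
    rw [← hφG x hx]
    exact (φ x).apply_symm_apply a
  have hiso := (P.fibre x).isIso_transport (t.continuousLinearEquivAt ℝ x hxt).toLinearEquiv α β γ
  exact (congrArg (φ x) (hiso.trans key)).trans (hφG' _)

end LocalTriviality

theorem mainTheorem2 {d : ℕ}
    {M : Type*} [TopologicalSpace M] [ChartedSpace (EuclideanSpace ℝ (Fin d)) M]
    [IsManifold (𝓡 d) ∞ M] [T2Space M] [SecondCountableTopology M] [ConnectedSpace M]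
    {F : Type*} [NormedAddCommGroup F] [NormedSpace ℝ F] [FiniteDimensional ℝ F]
    {V : M → Type*} [TopologicalSpace (TotalSpace F V)]
    [∀ x, AddCommGroup (V x)] [∀ x, Module ℝ (V x)] [∀ x, TopologicalSpace (V x)]
    [∀ x, IsTopologicalAddGroup (V x)] [∀ x, ContinuousSMul ℝ (V x)]
    [FiberBundle F V] [VectorBundle ℝ F V] [ContMDiffVectorBundle ∞ F V (𝓡 d)]
    (P : ParaAssociativeAlgebroid (𝓡 d) F V) :
    IsParaAssociativeAlgebraBundle (𝓡 d) (F := F) (fun m ↦ P.fibre m) ↔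
      ∃ D : CovariantDerivative (𝓡 d) F V, IsDifferentialConnection P D := by
  -- Together with second countability this gives the σ-compactness used for partitions of unity.
  have : LocallyCompactSpace M := ChartedSpace.locallyCompactSpace (EuclideanSpace ℝ (Fin d)) M
  exact ⟨fun h ↦ h.exists_isDifferentialConnection,
    fun ⟨_, hD⟩ ↦ hD.isParaAssociativeAlgebraBundle⟩
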